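/- Notation: $\mathbb T=\{z\in\mathbb C: |z|=1\}$, $\zeta_N=e^{2\pi i/N}$, $\mathbb Z_N=\mathbb Z/N\mathbb Z$. A quadratic form on an abelian group $G$ is a map $q:G\to\mathbb T$ with $q(-g)=q(g)$ such that $\langle g,h\rangle_q=q(g+h)q(g)^{-1}q(h)^{-1}$ is a bicharacter; it is non-degenerate if this bicharacter is. An involutive metric group is a triple $(A,q,\theta)$ with $A$ a finite abelian group, $q$ a non-degenerate quadratic form on $A$, and $\theta\in\mathrm{Aut}(A)$ with $\theta^2=1$ (the identity is allowed) and $q\circ\theta=q$; $A^\theta=\{a\in A:\theta(a)=a\}$. An isomorphism of such triples is a group isomorphism carrying $q$ to $q$ and $\theta$ to $\theta$. A flip form is a non-degenerate quadratic form $q'$ on $\mathbb Z_2\times\mathbb Z_2$ with $q'(x,y)=q'(y,x)$. In the formulas below, elements of $\mathbb Z_N$ in exponents are represented by integers in $\{0,\dots,N-1\}$. **Theorem.** Let $(A,q,\theta)$ be an involutive metric group with $A$ a 2-group and $A^\theta\cong\mathbb Z_2\times\mathbb Z_2$. The nonzero elements of $A^\theta$ can be labelled $a_0,a_1,a_2$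 so that the hypothesis of one of (1)–(8) below holds; and for every labelling $A^\theta=\{0,a_0,a_1,a_2\}$ the following hold, where each description of $(A,q,\theta)$ is up to isomorphism. 1. If $q(a_0)=-1$, $q(a_1)=q(a_2)=1$, then $A=\mathbb Z_2^2$, $q(x,y)=(-1)^{xy}$, $\theta=-1$. 2. If $q(a_0)=q(a_1)=q(a_2)=-1$, then $A=\mathbb Z_2^2$, $q(x,y)=(-1)^{x^2+xy+y^2}$, $\theta=-1$. 3. If $q(a_0)=-1$, $q(a_1)=q(a_2)=\varepsilon i$ with $\varepsilon\in\{1,-1\}$, then $A=\mathbb Z_2^2$, $q(x,y)=i^{\varepsilon(x^2+y^2)}$, $\theta=-1$. 4. If $q(a_0)=1$, $q(a_1)=i$, $q(a_2)=-i$, then $A=\mathbb Z_2^2$, $q(x,y)=i^{x^2-y^2}$, $\theta=-1$. 5. If $q(a_0)=-1$, $q(a_1)=i$, $q(a_2)=-i$, one of the following holds: - $A=\mathbb Z_2\times\mathbb Z_4$, $q(x,y)=\zeta_4^{r_1x^2}\zeta_8^{r_2y^2}$ with $r_1,r_2$ odd, $\theta=-1$; - $A=\mathbb Z_2^3$, $q(x,y,z)=\zeta_4^{rx^2}q'(y,z)$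 with $r$ odd and $q'$ a flip form, $\theta(x,y,z)=(x,z,y)$. 6. If $q(a_0)=1$, $q(a_1)=q(a_2)=-1$, one of the following holds: - $A=\mathbb Z_4\times\mathbb Z_{2^n}$ with $n\ge2$, $q(x,y)=\zeta_8^{r_1x^2}\zeta_{2^{n+1}}^{r_2y^2}$ with $r_1,r_2$ odd, and $\theta=-1$, or $n\ge3$ and $\theta(x,y)=(-x+2y,\,2^{n-1}x+(-1+2^{n-1})y)$; - $A=\mathbb Z_2\times\mathbb Z_2\times\mathbb Z_{2^n}$ with $n\ge2$, $q(x,y,z)=q'(x,y)\zeta_{2^{n+1}}^{rz^2}$ with $r$ odd and $q'$ a flip form, $\theta(x,y,z)=(y,x,-z)$; - $A=\mathbb Z_2^4$, $q(x_1,x_2,x_3,x_4)=q'(x_1,x_3)q''(x_2,x_4)$ with flip forms $q',q''$, $\theta(x_1,x_2,x_3,x_4)=(x_3,x_4,x_1,x_2)$. 7. If $q(a_0)=1$, $q(a_1)=q(a_2)=\varepsilon i$ with $\varepsilon\in\{1,-1\}$, then $A=\mathbb Z_2\times\mathbb Z_{2^n}$ with $n\ge3$, $q(x,y)=i^{\varepsilon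 x^2}\zeta_{2^{n+1}}^{ry^2}$ with $r$ odd, $\theta=-1$. 8. If $q(a_0)=q(a_1)=q(a_2)=1$, one of the following holds: - $A=\mathbb Z_{2^n}^2$ with $n\ge2$, $q(x,y)=\zeta_{2^n}^{xy}$ or $q(x,y)=\zeta_{2^n}^{x^2+xy+y^2}$, and $\theta=-1$, or $n\ge3$ and $\theta=-1+2^{n-1}$; - $A=\mathbb Z_{2^m}\times\mathbb Z_{2^n}$ with $3\le m\le n$, $q(x,y)=\zeta_{2^{m+1}}^{r_1x^2}\zeta_{2^{n+1}}^{r_2y^2}$ with $r_1,r_2$ odd, and $\theta=-1$ or $\theta(x,y)=(-x+2^{m-1}y,\,2^{n-1}x-y)$; - $A=\mathbb Z_2^4$, $q(x_1,x_2,x_3,x_4)=(-1)^{x_1x_4+x_2x_3}$ or $(-1)^{x_1x_4+x_2x_3}\,i^{(x_1+x_3)^2}$, and $\theta(x_1,x_2,x_3,x_4)=(x_3,x_4,x_1,x_2)$. -/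

import Mathlib

namespace InvMetric

/-- The map `⟨g, h⟩_q = q (g + h) q(g)⁻¹ q(h)⁻¹` attached to `q : G → 𝕋`. -/
noncomputable def polar {G : Type*} [AddCommGroup G] (q : G → Circle) (g h : G) : Circle :=
  q (g + h) * (q g)⁻¹ * (q h)⁻¹

/-- A quadratic form `q : G → 𝕋` in multiplicative notation: it is even, and `⟨·, ·⟩_q` is a
bicharacter. -/
structure IsQuadraticForm {G : Type*} [AddCommGroup G] (q : G → Circle) : Prop where
  even : ∀ g, q (-g) = q g
  polar_add_left : ∀ g g' h, polar q (g + g') h = polar q g h * polar q g' h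
  polar_add_right : ∀ g h h', polar q g (h + h') = polar q g h * polar q g h'

/-- A quadratic form whose (symmetric) bicharacter has trivial radical. On a finite group `G` this
says that `(G, q)` is a metric group. -/
structure IsNondegenerateForm {G : Type*} [AddCommGroup G] (q : G → Circle) : Prop
    extends IsQuadraticForm q where
  nondegenerate : ∀ g, (∀ h, polar q g h = 1) → g = 0

/-- `(G, q, θ)` is an involutive metric group: `G` is finite, `q` is a non-degenerate quadratic
form on `G`, and `θ` is an automorphism of `G` with `θ² = 1` (the identity is allowed) that
preserves `q`. -/
structure IsInvolutiveMetricGroup {G : Type*} [AddCommGroup G] (q : G → Circle) (θ : G ≃+ G) :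
    Prop where
  finite : Finite G
  form : IsNondegenerateForm q
  involutive : ∀ g, θ (θ g) = g
  preserves : ∀ g, q (θ g) = q g

/-- The fixed-point subgroup `G^θ`. -/
def fixedSubgroup {G : Type*} [AddCommGroup G] (θ : G ≃+ G) : AddSubgroup G where
  carrier := {g | θ g = g}
  zero_mem' := map_zero θ
  add_mem' := by
    intro a b ha hb
    simp only [Set.mem_ofPred_eq] at ha hb ⊢
    rw [map_add, ha, hb]
  neg_mem' := by
    intro a ha
    simp only [Set.mem_ofPred_eq] at ha ⊢
    rw [map_neg, ha]

/-- The triples `(G, q, θ)` and `(H, q', θ')` are isomorphic: some group isomorphism `G ≃ H` carries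
`q` to `q'` and `θ` to `θ'`. -/
def IsIso {G H : Type*} [AddCommGroup G] [AddCommGroup H] (q : G → Circle) (θ : G ≃+ G)
    (q' : H → Circle) (θ' : H → H) : Prop :=
  ∃ e : G ≃+ H, (∀ g, q' (e g) = q g) ∧ ∀ g, e (θ g) = θ' (e g)

/-- The primitive root of unity `ζ_N = exp(2πi/N)`, as an element of the unit circle. -/
noncomputable def zeta (N : ℕ) : Circle := Circle.exp (2 * Real.pi / N)

theorem coe_zeta_two : (zeta 2 : ℂ) = -1 := by
  have h : ((2 * Real.pi / (2 : ℕ) : ℝ) : ℂ) * Complex.I = Real.pi * Complex.I := by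
    push_cast
    ring
  rw [zeta, Circle.coe_exp, h, Complex.exp_pi_mul_I]

theorem coe_zeta_four : (zeta 4 : ℂ) = Complex.I := by
  have h : ((2 * Real.pi / (4 : ℕ) : ℝ) : ℂ) * Complex.I = Real.pi / 2 * Complex.I := by
    push_cast
    ring
  rw [zeta, Circle.coe_exp, h, Complex.exp_pi_div_two_mul_I]

/-- The form `x ↦ ζ_{2N}^{r x²}` on `ℤ/N`, evaluated at the representative of `x` in `{0, …, N-1}`;
for even `N` any other representative gives the same value. -/
noncomputable def cyclicForm (N : ℕ) (r : ℤ) (x : ZMod N) : Circle :=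
  zeta (2 * N) ^ (r * (x.val : ℤ) ^ 2)

/-- The form `(x, y) ↦ ζ_N^{xy}` on `(ℤ/N)²`. -/
noncomputable def hyperbolicForm (N : ℕ) (p : ZMod N × ZMod N) : Circle :=
  zeta N ^ (p.1.val * p.2.val)

/-- The form `(x, y) ↦ ζ_N^{x² + xy + y²}` on `(ℤ/N)²`. -/
noncomputable def ellipticForm (N : ℕ) (p : ZMod N × ZMod N) : Circle :=
  zeta N ^ (p.1.val ^ 2 + p.1.val * p.2.val + p.2.val ^ 2)

/-- The orthogonal sum `(x, y) ↦ q(x) q'(y)`. -/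
noncomputable def prodForm {G H : Type*} (q : G → Circle) (q' : H → Circle) (p : G × H) : Circle :=
  q p.1 * q' p.2

/-- A non-degenerate quadratic form on `(ℤ/2)²` that is invariant under `(x, y) ↦ (y, x)`. -/
def IsFlipForm (q : ZMod 2 × ZMod 2 → Circle) : Prop :=
  IsNondegenerateForm q ∧ ∀ x y, q (y, x) = q (x, y)

/-- The map `(x, y) ↦ (-x + 2y, 2^(n-1) x + (-1 + 2^(n-1)) y)` on `ℤ/4 × ℤ/2ⁿ` (for `n ≥ 3`). -/
def twistFour (n : ℕ) (p : ZMod 4 × ZMod (2 ^ n)) : ZMod 4 × ZMod (2 ^ n) :=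
  (-p.1 + 2 * (p.2.val : ZMod 4),
    2 ^ (n - 1) * (p.1.val : ZMod (2 ^ n)) + (-1 + 2 ^ (n - 1)) * p.2)

/-- The map `(x, y) ↦ (-x + 2^(m-1) y, 2^(n-1) x - y)` on `ℤ/2ᵐ × ℤ/2ⁿ` (for `m, n ≥ 3`). -/
def twistDiag (m n : ℕ) (p : ZMod (2 ^ m) × ZMod (2 ^ n)) : ZMod (2 ^ m) × ZMod (2 ^ n) :=
  (-p.1 + 2 ^ (m - 1) * (p.2.val : ZMod (2 ^ m)),
    2 ^ (n - 1) * (p.1.val : ZMod (2 ^ n)) - p.2)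

/-- The map `(x₁, x₂, x₃, x₄) ↦ (x₃, x₄, x₁, x₂)` on `(ℤ/2)⁴`. -/
def swapFour (p : ZMod 2 × ZMod 2 × ZMod 2 × ZMod 2) : ZMod 2 × ZMod 2 × ZMod 2 × ZMod 2 :=
  (p.2.2.1, p.2.2.2, p.1, p.2.1)

/-- The form `(x₁, x₂, x₃, x₄) ↦ (-1)^{x₁x₄ + x₂x₃}` on `(ℤ/2)⁴` (note that `ζ_2 = -1`). -/
noncomputable def crossForm (p : ZMod 2 × ZMod 2 × ZMod 2 × ZMod 2) : Circle :=
  zeta 2 ^ (p.1.val * p.2.2.2.val + p.2.1.val * p.2.2.1.val)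

/-- The form `(x₁, x₂, x₃, x₄) ↦ (-1)^{x₁x₄ + x₂x₃} i^{(x₁ + x₃)²}` on `(ℤ/2)⁴` (note that
`ζ_4 = i`). -/
noncomputable def crossForm' (p : ZMod 2 × ZMod 2 × ZMod 2 × ZMod 2) : Circle :=
  crossForm p * zeta 4 ^ ((p.1.val + p.2.2.1.val) ^ 2)

/-- `q` takes the values `v₀, v₁, v₂` at `a₀, a₁, a₂`. -/
def TakesValues {G : Type*} (q : G → Circle) (a₀ a₁ a₂ : G) (v₀ v₁ v₂ : ℂ) : Prop :=
  (q a₀ : ℂ) = v₀ ∧ (q a₁ : ℂ) = v₁ ∧ (q a₂ : ℂ) = v₂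

end InvMetric

/-! Write V for the group of fixed points. Two facts carry everything. First, θ is self-adjoint for
the pairing, so V is the orthogonal complement of the image of 1 - θ. By double orthogonality,
anything orthogonal to V lies in that image and is negated by θ (`map_eq_neg`). In particular, an
involution orthogonal to V is itself fixed. Second, the trace z + θz lies in V and satisfies q(z +
θz) = ⟨z + θz, z⟩ (`form_add_map`), so the values of q on V restrict which traces can occur.

Each model is mapped into A by choosing images of generators. Since A is a 2-group, injectivity and
triviality of the orthogonal complement of the image need only be tested on involutions. Once the
image contains V, the second test reduces to fixed points (`surjective_of_klein`).

The argument divides according to the pairing on V. If it is nondegenerate, A = V. If it has rank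
one, a line spanned by some a with q(a) = ±i splits off, and its complement has a single nonzero
fixed point. Such a complement yields either a plane swapped by θ or a cyclic group on which θ = -1
(`exists_flip_or_cyclic`).

If V is totally isotropic for the pairing, the action on involutions matters. A moved involution
whose trace has q = -1 splits off a swapped plane, and the same dichotomy applies to the complement
(`classify_of_flip`). If q = 1 on its trace, there must be another moved involution with a different
nonzero trace (`false_of_unique_trace`). When q = 1 on V, two such involutions and their images span
A (`isIso_cross_or`).

If every involution is fixed, A has rank two. Either some c with 2^(k+1) c = 0 satisfies ⟨c, 2^k c⟩
= -1, and c extends to an orthogonal basis, or the form is even and a Hensel argument reduces it to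
the hyperbolic or elliptic plane. In both situations θ is determined by the traces of two
generators, and few choices survive the two facts above. -/

namespace InvMetric

/-! ### Quadratic forms -/

namespace IsQuadraticForm

variable {G H : Type*} [AddCommGroup G] [AddCommGroup H] {q : G → Circle}

theorem polar_comm (q : G → Circle) (g h : G) : polar q g h = polar q h g := by
  simp only [polar, add_comm g h, mul_right_comm]

theorem map_add (q : G → Circle) (g h : G) : q (g + h) = q g * q h * polar q g h := by
  simp only [polar]
  rw [mul_assoc (q (g + h)), mul_comm (q (g + h)), ← mul_assoc]
  simp [mul_comm (q g)]

/-- The homomorphism `h ↦ ⟨g, h⟩_q`. -/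
noncomputable def polarHom (Q : IsQuadraticForm q) (g : G) : G →+ Additive Circle where
  toFun h := Additive.ofMul (polar q g h)
  map_zero' := by
    have := Q.polar_add_right g 0 0
    rw [add_zero, left_eq_mul] at this
    rw [this]; rfl
  map_add' x y := by rw [Q.polar_add_right]; rfl

theorem polar_zero_right (Q : IsQuadraticForm q) (g : G) : polar q g 0 = 1 :=
  (Q.polarHom g).map_zero

theorem polar_zero_left (Q : IsQuadraticForm q) (g : G) : polar q 0 g = 1 := by
  rw [polar_comm, Q.polar_zero_right]

theorem polar_neg_right (Q : IsQuadraticForm q) (g h : G) : polar q g (-h) = (polar q g h)⁻¹ :=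
  (Q.polarHom g).map_neg h

theorem polar_neg_left (Q : IsQuadraticForm q) (g h : G) : polar q (-g) h = (polar q g h)⁻¹ := by
  rw [polar_comm, Q.polar_neg_right, polar_comm]

theorem polar_sub_right (Q : IsQuadraticForm q) (g h k : G) :
    polar q g (h - k) = polar q g h * (polar q g k)⁻¹ := by
  rw [sub_eq_add_neg, Q.polar_add_right, Q.polar_neg_right]

theorem polar_sub_left (Q : IsQuadraticForm q) (g h k : G) :
    polar q (g - h) k = polar q g k * (polar q h k)⁻¹ := by
  rw [sub_eq_add_neg, Q.polar_add_left, Q.polar_neg_left]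

theorem polar_zsmul_right (Q : IsQuadraticForm q) (g h : G) (n : ℤ) :
    polar q g (n • h) = polar q g h ^ n :=
  (Q.polarHom g).map_zsmul n h

theorem polar_zsmul_left (Q : IsQuadraticForm q) (g h : G) (n : ℤ) :
    polar q (n • g) h = polar q g h ^ n := by
  rw [polar_comm, Q.polar_zsmul_right, polar_comm]

theorem polar_nsmul_right (Q : IsQuadraticForm q) (g h : G) (n : ℕ) :
    polar q g (n • h) = polar q g h ^ n :=
  (Q.polarHom g).map_nsmul n h

theorem polar_nsmul_left (Q : IsQuadraticForm q) (g h : G) (n : ℕ) :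
    polar q (n • g) h = polar q g h ^ n := by
  rw [polar_comm, Q.polar_nsmul_right, polar_comm]

theorem map_zero (Q : IsQuadraticForm q) : q 0 = 1 := by
  have := Q.polar_zero_right 0
  simpa [polar] using this

/-- Evenness enters here: expand q(g + (-g)) = 1. -/
theorem polar_self (Q : IsQuadraticForm q) (g : G) : polar q g g = q g ^ 2 := by
  have h := map_add q g (-g)
  rw [add_neg_cancel, Q.map_zero, Q.even, Q.polar_neg_right, ← sq] at h
  exact (mul_inv_eq_one.1 h.symm).symm

theorem map_zsmul (Q : IsQuadraticForm q) (g : G) (n : ℤ) : q (n • g) = q g ^ (n ^ 2) := by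
  have key : ∀ n : ℕ, q (n • g) = q g ^ (n ^ 2) := by
    intro n
    induction n with
    | zero => simp [Q.map_zero]
    | succ n ih =>
      rw [succ_nsmul, map_add q, ih, Q.polar_nsmul_left, Q.polar_self, ← pow_mul, ← pow_succ,
        ← pow_add]
      congr 1; ring
  obtain ⟨n, rfl | rfl⟩ := n.eq_nat_or_neg
  · rw [natCast_zsmul, key]; exact_mod_cast rfl
  · rw [neg_smul, Q.even, natCast_zsmul, key, neg_sq]; exact_mod_cast rfl

theorem map_nsmul (Q : IsQuadraticForm q) (g : G) (n : ℕ) : q (n • g) = q g ^ (n ^ 2) := by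
  have := Q.map_zsmul g n
  rw [natCast_zsmul] at this
  exact_mod_cast this

/-- The value of a quadratic form on an integral combination of two elements. -/
theorem map_zsmul_add_zsmul (Q : IsQuadraticForm q) (g h : G) (m n : ℤ) :
    q (m • g + n • h) = q g ^ (m ^ 2) * q h ^ (n ^ 2) * polar q g h ^ (m * n) := by
  rw [map_add q, Q.map_zsmul, Q.map_zsmul, Q.polar_zsmul_left, Q.polar_zsmul_right, ← zpow_mul,
    mul_comm n m]

theorem polar_comp (f : H →+ G) (g h : H) : polar (fun x => q (f x)) g h = polar q (f g) (f h) := by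
  simp [polar]

theorem comp (Q : IsQuadraticForm q) (f : H →+ G) : IsQuadraticForm fun x => q (f x) where
  even g := by rw [_root_.map_neg, Q.even]
  polar_add_left g g' h := by simp only [polar_comp, _root_.map_add, Q.polar_add_left]
  polar_add_right g g' h := by simp only [polar_comp, _root_.map_add, Q.polar_add_right]

end IsQuadraticForm

/-! ### Values on the circle -/

theorem circle_neg_one_ne_one : (-1 : Circle) ≠ 1 := Circle.neg_ne_self 1

theorem circle_sq_eq_one {z : Circle} : z ^ 2 = 1 ↔ z = 1 ∨ z = -1 := by
  rw [Circle.ext_iff, Circle.ext_iff, Circle.ext_iff]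
  simp

theorem isPrimitiveRoot_zeta (N : ℕ) (hN : N ≠ 0) : IsPrimitiveRoot (zeta N : ℂ) N := by
  have := Complex.isPrimitiveRoot_exp N hN
  rw [zeta, Circle.coe_exp]
  convert this using 2
  push_cast; ring

theorem zeta_pow_self (N : ℕ) (hN : N ≠ 0) : zeta N ^ N = 1 :=
  Circle.ext (by simpa using (isPrimitiveRoot_zeta N hN).pow_eq_one)

theorem zeta_mul_pow (M N : ℕ) (hM : M ≠ 0) : zeta (M * N) ^ M = zeta N := by
  rw [zeta, zeta, ← Circle.exp_nsmul]
  congr 1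
  have : (M : ℝ) ≠ 0 := Nat.cast_ne_zero.2 hM
  rw [nsmul_eq_mul]
  push_cast
  rw [mul_div_assoc', mul_div_mul_left _ _ this]

theorem zeta_two : zeta 2 = -1 := Circle.ext (by simp [coe_zeta_two])

theorem zeta_two_mul_pow (N : ℕ) (hN : N ≠ 0) : zeta (2 * N) ^ N = -1 := by
  rw [mul_comm, zeta_mul_pow _ _ hN, zeta_two]

theorem exists_zeta_zpow {z : Circle} {N : ℕ} (hN : N ≠ 0) (h : z ^ N = 1) :
    ∃ r : ℕ, z = zeta N ^ r := by
  have : NeZero N := ⟨hN⟩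
  obtain ⟨r, -, hr⟩ := (isPrimitiveRoot_zeta N hN).eq_pow_of_pow_eq_one
    (ξ := (z : ℂ)) (by rw [← Circle.coe_pow, h]; rfl)
  exact ⟨r, Circle.ext (by simpa using hr.symm)⟩

theorem exists_odd_zeta_zpow {z : Circle} {N : ℕ} (hN : N ≠ 0) (h : z ^ N = -1) :
    ∃ r : ℤ, Odd r ∧ z = zeta (2 * N) ^ r := by
  obtain ⟨r, hr⟩ := exists_zeta_zpow (z := z) (N := 2 * N) (by positivity)
    (by rw [mul_comm 2 N, pow_mul, h]; simp)
  refine ⟨r, ?_, by simpa using hr⟩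
  rw [hr, ← pow_mul, mul_comm r N, pow_mul, zeta_two_mul_pow N hN] at h
  by_contra hodd
  rw [Int.not_odd_iff_even, Int.even_coe_nat] at hodd
  rw [hodd.neg_one_pow] at h
  exact circle_neg_one_ne_one h.symm

/-! ### Duality in involutive metric groups -/

/-- A nondegenerate bicharacter realizes every character. -/
theorem IsNondegenerateForm.exists_polar_eq {A : Type*} [AddCommGroup A] [Finite A]
    {q : A → Circle} (Q : IsNondegenerateForm q) (χ : AddChar A Circle) :
    ∃ y, ∀ x, polar q y x = χ x := by
  let F : A → AddChar A Circle := fun y =>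
    { toFun := polar q y
      map_zero_eq_one' := Q.polar_zero_right y
      map_add_eq_mul' := Q.polar_add_right y }
  have hF : Function.Injective F := by
    intro x y h
    rw [← sub_eq_zero]
    refine Q.nondegenerate _ fun z => ?_
    rw [Q.polar_sub_left, mul_inv_eq_one]
    exact DFunLike.congr_fun h z
  have hb : Function.Bijective F := by
    have : Finite (AddChar A Circle) := Finite.of_equiv _ AddChar.circleEquivComplex.symm.toEquiv
    cases nonempty_fintype A
    cases nonempty_fintype (AddChar A Circle)
    rw [Fintype.bijective_iff_injective_and_card]
    refine ⟨hF, ?_⟩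
    rw [← AddChar.card_eq, Fintype.card_congr AddChar.circleEquivComplex.toEquiv]
  obtain ⟨y, hy⟩ := hb.2 χ
  exact ⟨y, fun x => DFunLike.congr_fun hy x⟩

/-- If x were outside R, some character of A/R would be nontrivial at x. That character is pairing
with some y, which is then orthogonal to R but not to x. -/
theorem IsNondegenerateForm.mem_of_perp_perp {A : Type*} [AddCommGroup A] [Finite A]
    {q : A → Circle} (Q : IsNondegenerateForm q) (R : AddSubgroup A) (x : A)
    (h : ∀ y, (∀ r ∈ R, polar q y r = 1) → polar q y x = 1) : x ∈ R := by
  by_contra hx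
  have hx' : (QuotientAddGroup.mk x : A ⧸ R) ≠ 0 := by
    rwa [Ne, QuotientAddGroup.eq_zero_iff]
  obtain ⟨ψ, hψ⟩ := AddChar.exists_apply_ne_zero.2 hx'
  obtain ⟨y, hy⟩ := Q.exists_polar_eq
    ((AddChar.circleEquivComplex.symm ψ).compAddMonoidHom (QuotientAddGroup.mk' R))
  have hval : ∀ z, (polar q y z : ℂ) = ψ (QuotientAddGroup.mk z) := fun z => by
    rw [hy z]; rfl
  apply hψ
  rw [← hval, h y]
  · rfl
  · intro r hr
    apply Circle.ext
    rw [hval, (QuotientAddGroup.eq_zero_iff r).2 hr, AddChar.map_zero_eq_one]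
    rfl

namespace IsInvolutiveMetricGroup

variable {A : Type*} [AddCommGroup A] {q : A → Circle} {θ : A ≃+ A}

theorem quad (M : IsInvolutiveMetricGroup q θ) : IsQuadraticForm q := M.form.toIsQuadraticForm

theorem polar_map_map (M : IsInvolutiveMetricGroup q θ) (g h : A) :
    polar q (θ g) (θ h) = polar q g h := by
  simp only [polar, ← map_add, M.preserves]

theorem polar_map_left (M : IsInvolutiveMetricGroup q θ) (g h : A) :
    polar q (θ g) h = polar q g (θ h) := by
  rw [← M.polar_map_map, M.involutive]

/-- Self-adjointness of θ identifies the complement of the image of 1 - θ with the fixed points. So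
x lies in that image, where θ = -1 because θ² = 1. -/
theorem map_eq_neg (M : IsInvolutiveMetricGroup q θ) {x : A}
    (h : ∀ v, θ v = v → polar q x v = 1) : θ x = -x := by
  have := M.finite
  have hx : x ∈ (AddMonoidHom.id A - θ.toAddMonoidHom).range := by
    refine M.form.mem_of_perp_perp _ _ fun y hy => ?_
    rw [IsQuadraticForm.polar_comm]
    apply h
    rw [eq_comm, ← sub_eq_zero]
    refine M.form.nondegenerate _ fun z => ?_
    rw [M.quad.polar_sub_left, M.polar_map_left, ← M.quad.polar_sub_right]
    exact hy _ ⟨z, by simp⟩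
  obtain ⟨z, hz⟩ := hx
  have hz : z - θ z = x := by simpa using hz
  rw [← hz, map_sub, M.involutive]
  abel

theorem map_add_map (M : IsInvolutiveMetricGroup q θ) (z : A) : θ (z + θ z) = z + θ z := by
  rw [map_add, M.involutive, add_comm]

/-- Both sides are q(z)²⟨z, θz⟩. This converts a value of q at a fixed point into a pairing with any
element having it as trace. -/
theorem form_add_map (M : IsInvolutiveMetricGroup q θ) (z : A) :
    q (z + θ z) = polar q (z + θ z) z := by
  rw [IsQuadraticForm.map_add q, M.preserves, ← sq, ← M.quad.polar_self, M.quad.polar_add_left,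
    IsQuadraticForm.polar_comm q (θ z)]

theorem exists_polar_eq_neg_one (M : IsInvolutiveMetricGroup q θ) {x : A} (hx : x ≠ 0)
    (h2 : x + x = 0) : ∃ y, polar q y x = -1 := by
  by_contra! h
  refine hx (M.form.nondegenerate _ fun y => ?_)
  have := h y
  rw [IsQuadraticForm.polar_comm] at this
  exact (circle_sq_eq_one.1 (by
    rw [sq, ← M.quad.polar_add_left, h2, M.quad.polar_zero_left])).resolve_right this

end IsInvolutiveMetricGroup

/-! ### Two-groups -/

theorem exists_pow_smul_ne_zero {G : Type*} [AddCommGroup G] (h : ∃ k : ℕ, Nat.card G = 2 ^ k)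
    {x : G} (hx : x ≠ 0) : ∃ k : ℕ, 2 ^ k • x ≠ 0 ∧ 2 ^ (k + 1) • x = 0 := by
  obtain ⟨K, hK⟩ := h
  have hex : ∃ k : ℕ, 2 ^ k • x = 0 := ⟨K, by rw [← hK]; exact card_nsmul_eq_zero'⟩
  classical
  have h0 : Nat.find hex ≠ 0 := by
    intro h0
    have := Nat.find_spec hex
    rw [h0] at this
    exact hx (by simpa using this)
  obtain ⟨k, hk⟩ := Nat.exists_eq_succ_of_ne_zero h0
  refine ⟨k, Nat.find_min hex (by omega), ?_⟩
  have := Nat.find_spec hex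
  rwa [hk] at this

/-- A homomorphism from a two-group that is injective on involutions is injective. -/
theorem injective_of_involutions {G H : Type*} [AddCommGroup G] [AddCommGroup H]
    (h : ∃ k : ℕ, Nat.card H = 2 ^ k) (f : H →+ G) (hf : ∀ x, x + x = 0 → f x = 0 → x = 0) :
    Function.Injective f := by
  rw [injective_iff_map_eq_zero]
  intro x hx
  by_contra h0
  obtain ⟨k, hk, hk'⟩ := exists_pow_smul_ne_zero h h0
  refine hk (hf _ ?_ (by rw [map_nsmul, hx, smul_zero]))
  rw [← two_nsmul, ← mul_nsmul, ← pow_succ, hk']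

/-- The orthogonal complement of the image is a subgroup of a 2-group, so if nonzero it contains an
involution. Double orthogonality does the rest. -/
theorem surjective_of_involutions {A H : Type*} [AddCommGroup A] [AddCommGroup H]
    {q : A → Circle} {θ : A ≃+ A} (M : IsInvolutiveMetricGroup q θ)
    (h : ∃ k : ℕ, Nat.card A = 2 ^ k) (f : H →+ A)
    (hf : ∀ y, y + y = 0 → (∀ x, polar q y (f x) = 1) → y = 0) : Function.Surjective f := by
  have := M.finite
  intro a
  refine M.form.mem_of_perp_perp f.range a fun y hy => ?_
  have hy0 : y = 0 := by
    by_contra h0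
    obtain ⟨k, hk, hk'⟩ := exists_pow_smul_ne_zero h h0
    refine hk (hf _ ?_ fun x => ?_)
    · rw [← two_nsmul, ← mul_nsmul, ← pow_succ, hk']
    · rw [M.quad.polar_nsmul_left, hy _ ⟨x, rfl⟩, one_pow]
  rw [hy0, M.quad.polar_zero_left]

theorem isIso_of_hom {A H : Type*} [AddCommGroup A] [AddCommGroup H] {q : A → Circle} {θ : A ≃+ A}
    {q' : H → Circle} {θ' : H → H} (f : H →+ A) (hinj : Function.Injective f)
    (hsurj : Function.Surjective f) (hq : ∀ x, q (f x) = q' x) (hθ : ∀ x, θ (f x) = f (θ' x)) :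
    IsIso q θ q' θ' := by
  let e := AddEquiv.ofBijective f ⟨hinj, hsurj⟩
  have he : ∀ x, f (e.symm x) = x := fun x => e.apply_symm_apply x
  refine ⟨e.symm, fun g => ?_, fun g => ?_⟩
  · rw [← hq, he]
  · apply hinj
    rw [← hθ, he, he]

/-- The homomorphism `ZMod N →+ A` sending `1` to an element killed by `N`. -/
def cyc {A : Type*} [AddCommGroup A] {N : ℕ} {c : A} (h : N • c = 0) : ZMod N →+ A :=
  ZMod.lift N ⟨(zmultiplesHom A c), by simpa using h⟩

@[simp]
theorem cyc_intCast {A : Type*} [AddCommGroup A] {N : ℕ} {c : A} (h : N • c = 0) (i : ℤ) :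
    cyc h (i : ZMod N) = i • c := by
  rw [cyc, ZMod.lift_coe]; rfl

theorem zmod_exists_eq {N : ℕ} [NeZero N] (x : ZMod N) : ((x.val : ℤ) : ZMod N) = x := by
  simp

theorem cyc_apply {A : Type*} [AddCommGroup A] {N : ℕ} [NeZero N] {c : A} (h : N • c = 0)
    (x : ZMod N) : cyc h x = (x.val : ℤ) • c := by
  conv_lhs => rw [← zmod_exists_eq x]
  rw [cyc_intCast]

/-- An involution of `ℤ/2ⁿ⁺¹` is `0` or `2ⁿ`. -/
theorem zmod_two_pow_involution {n : ℕ} (x : ZMod (2 ^ (n + 1))) (h : x + x = 0) :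
    x = 0 ∨ x = ((2 ^ n : ℤ) : ZMod (2 ^ (n + 1))) := by
  obtain ⟨i, rfl⟩ := ZMod.intCast_surjective x
  rw [← Int.cast_add, ZMod.intCast_zmod_eq_zero_iff_dvd] at h
  obtain ⟨j, hj⟩ := h
  have hi : i = 2 ^ n * j := by
    push_cast [pow_succ] at hj
    linarith
  obtain ⟨l, rfl | rfl⟩ := j.even_or_odd'
  · left
    rw [ZMod.intCast_zmod_eq_zero_iff_dvd]
    exact ⟨l, by rw [hi]; push_cast; ring⟩
  · right
    rw [ZMod.intCast_eq_intCast_iff_dvd_sub]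
    exact ⟨-l, by rw [hi]; push_cast; ring⟩


/-! ### Fixed points forming a Klein four-group -/

/-- The fixed points of `θ` are the four distinct elements `0, u, v, u + v`, all killed by two. -/
structure IsKlein {A : Type*} [AddCommGroup A] (θ : A ≃+ A) (u v : A) : Prop where
  add_self_left : u + u = 0
  add_self_right : v + v = 0
  map_left : θ u = u
  map_right : θ v = v
  left_ne : u ≠ 0
  right_ne : v ≠ 0
  ne : u ≠ v
  mem : ∀ g, θ g = g → g = 0 ∨ g = u ∨ g = v ∨ g = u + v

namespace IsKlein

variable {A : Type*} [AddCommGroup A] {θ : A ≃+ A} {u v : A}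

theorem add_ne_zero (K : IsKlein θ u v) : u + v ≠ 0 := fun h =>
  K.ne (by rw [← add_left_inj v, h, K.add_self_right])

theorem symm (K : IsKlein θ u v) : IsKlein θ v u where
  add_self_left := K.add_self_right
  add_self_right := K.add_self_left
  map_left := K.map_right
  map_right := K.map_left
  left_ne := K.right_ne
  right_ne := K.left_ne
  ne := K.ne.symm
  mem g hg := by
    rw [add_comm v u]
    rcases K.mem g hg with h | h | h | h <;> simp [h]

theorem add_add_self (K : IsKlein θ u v) : u + (u + v) = v := by
  rw [← add_assoc, K.add_self_left, zero_add]

theorem add_right (K : IsKlein θ u v) : IsKlein θ u (u + v) where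
  add_self_left := K.add_self_left
  add_self_right := by rw [add_add_add_comm, K.add_self_left, K.add_self_right, add_zero]
  map_left := K.map_left
  map_right := by rw [map_add, K.map_left, K.map_right]
  left_ne := K.left_ne
  right_ne := K.add_ne_zero
  ne h := K.right_ne (by simpa using h.symm)
  mem g hg := by
    rw [K.add_add_self]
    rcases K.mem g hg with h | h | h | h <;> simp [h]

theorem add_self (K : IsKlein θ u v) {g : A} (hg : θ g = g) : g + g = 0 := by
  rcases K.mem g hg with rfl | rfl | rfl | rfl
  · simp
  · exact K.add_self_left
  · exact K.add_self_right
  · exact K.add_right.add_self_right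

end IsKlein

theorem neg_eq_self {A : Type*} [AddCommGroup A] {x : A} (h : x + x = 0) : -x = x :=
  neg_eq_of_add_eq_zero_left h

namespace IsInvolutiveMetricGroup

variable {A : Type*} [AddCommGroup A] {q : A → Circle} {θ : A ≃+ A} {u v : A}

theorem map_eq_neg_of_klein (M : IsInvolutiveMetricGroup q θ) (K : IsKlein θ u v) {x : A}
    (hu : polar q x u = 1) (hv : polar q x v = 1) : θ x = -x := by
  refine M.map_eq_neg fun w hw => ?_
  rcases K.mem w hw with rfl | rfl | rfl | rfl
  · exact M.quad.polar_zero_right x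
  · exact hu
  · exact hv
  · rw [M.quad.polar_add_right, hu, hv, one_mul]

theorem map_eq_self_of_klein (M : IsInvolutiveMetricGroup q θ) (K : IsKlein θ u v) {x : A}
    (hx : x + x = 0) (hu : polar q x u = 1) (hv : polar q x v = 1) : θ x = x := by
  rw [M.map_eq_neg_of_klein K hu hv, neg_eq_self hx]

theorem polar_sq (M : IsInvolutiveMetricGroup q θ) {x : A} (hx : x + x = 0) (y : A) :
    polar q y x ^ 2 = 1 := by
  rw [sq, ← M.quad.polar_add_right, hx, M.quad.polar_zero_right]

theorem polar_eq_or (M : IsInvolutiveMetricGroup q θ) {x : A} (hx : x + x = 0) (y : A) :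
    polar q y x = 1 ∨ polar q y x = -1 :=
  circle_sq_eq_one.1 (M.polar_sq hx y)

/-- An involution orthogonal to the image is orthogonal to u and v, hence fixed. Only the four fixed
points remain to be tested. -/
theorem surjective_of_klein {H : Type*} [AddCommGroup H] (M : IsInvolutiveMetricGroup q θ)
    (h : ∃ k : ℕ, Nat.card A = 2 ^ k) (K : IsKlein θ u v) (f : H →+ A)
    (hu : ∃ x, f x = u) (hv : ∃ x, f x = v)
    (hf : ∀ y, θ y = y → (∀ x, polar q y (f x) = 1) → y = 0) : Function.Surjective f := by
  refine surjective_of_involutions M h f fun y hy hfy => hf y ?_ hfy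
  obtain ⟨x, hx⟩ := hu
  obtain ⟨x', hx'⟩ := hv
  exact M.map_eq_self_of_klein K hy (by rw [← hx, hfy]) (by rw [← hx', hfy])

end IsInvolutiveMetricGroup

/-! ### Building blocks for isomorphisms -/

theorem IsIso.congr {A H H' : Type*} [AddCommGroup A] [AddCommGroup H] [AddCommGroup H']
    {q : A → Circle} {θ : A ≃+ A} {q' : H → Circle} {θ' : H → H} {q'' : H' → Circle}
    {θ'' : H' → H'} (h : IsIso q θ q' θ') (e : H ≃+ H') (hq : ∀ x, q'' (e x) = q' x)
    (hθ : ∀ x, e (θ' x) = θ'' (e x)) : IsIso q θ q'' θ'' := by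
  obtain ⟨e₀, h₁, h₂⟩ := h
  exact ⟨e₀.trans e, fun g => by simp [hq, h₁], fun g => by simp [h₂, hθ]⟩

theorem form_cyc {A : Type*} [AddCommGroup A] {q : A → Circle} (Q : IsQuadraticForm q) {N : ℕ}
    [NeZero N] {c : A} (h : N • c = 0) {r : ℤ} (hr : q c = zeta (2 * N) ^ r) (x : ZMod N) :
    q (cyc h x) = cyclicForm N r x := by
  rw [cyc_apply, Q.map_zsmul, hr, ← zpow_mul, cyclicForm]

theorem polar_cyc_cyc {A : Type*} [AddCommGroup A] {q : A → Circle} (Q : IsQuadraticForm q)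
    {N N' : ℕ} [NeZero N] [NeZero N'] {c d : A} (h : N • c = 0) (h' : N' • d = 0)
    (hcd : polar q c d = 1) (x : ZMod N) (y : ZMod N') : polar q (cyc h x) (cyc h' y) = 1 := by
  rw [cyc_apply, cyc_apply, Q.polar_zsmul_left, Q.polar_zsmul_right, hcd, one_zpow, one_zpow]

theorem form_coprod {A H H' : Type*} [AddCommGroup A] [AddCommGroup H] [AddCommGroup H']
    {q : A → Circle} (f : H →+ A) (g : H' →+ A)
    (h : ∀ x y, polar q (f x) (g y) = 1) (p : H × H') :
    q (f.coprod g p) = q (f p.1) * q (g p.2) := by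
  rw [AddMonoidHom.coprod_apply, IsQuadraticForm.map_add q, h, mul_one]

/-- If f x = -g y, then f x is orthogonal to the whole image of f, and nondegeneracy gives x = 0. -/
theorem injective_coprod_of_polar {A H H' : Type*} [AddCommGroup A] [AddCommGroup H]
    [AddCommGroup H'] {q : A → Circle} (Q : IsQuadraticForm q) (f : H →+ A) (g : H' →+ A)
    (h : ∀ x y, polar q (f x) (g y) = 1) (hf : IsNondegenerateForm fun x => q (f x))
    (hg : Function.Injective g) : Function.Injective (f.coprod g) := by
  rw [injective_iff_map_eq_zero]
  rintro ⟨x, y⟩ hxy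
  rw [AddMonoidHom.coprod_apply] at hxy
  have hx : x = 0 := by
    refine hf.nondegenerate x fun x' => ?_
    rw [IsQuadraticForm.polar_comp, eq_neg_of_add_eq_zero_left hxy, Q.polar_neg_left,
      IsQuadraticForm.polar_comm, h, inv_one]
  have hy : y = 0 := (injective_iff_map_eq_zero g).1 hg y (by simpa [hx] using hxy)
  rw [hx, hy]; rfl

theorem card_zmod_two_pow (n : ℕ) : Nat.card (ZMod (2 ^ n)) = 2 ^ n := by simp

theorem card_prod_two_pow {H H' : Type*} (h : ∃ k : ℕ, Nat.card H = 2 ^ k)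
    (h' : ∃ k : ℕ, Nat.card H' = 2 ^ k) : ∃ k : ℕ, Nat.card (H × H') = 2 ^ k := by
  obtain ⟨k, hk⟩ := h
  obtain ⟨l, hl⟩ := h'
  exact ⟨k + l, by rw [Nat.card_prod, hk, hl, pow_add]⟩

theorem injective_coprod_of_involutions {A H H' : Type*} [AddCommGroup A] [AddCommGroup H]
    [AddCommGroup H'] (hH : ∃ k : ℕ, Nat.card H = 2 ^ k) (hH' : ∃ k : ℕ, Nat.card H' = 2 ^ k)
    (f : H →+ A) (g : H' →+ A) {u v : A} (hf : ∀ x, x + x = 0 → x = 0 ∨ f x = u)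
    (hg : ∀ x, x + x = 0 → x = 0 ∨ g x = v) (hu : u ≠ 0) (hv : v ≠ 0) (huv : u + v ≠ 0) :
    Function.Injective (f.coprod g) := by
  refine injective_of_involutions (card_prod_two_pow hH hH') _ ?_
  rintro ⟨x, y⟩ hxy h
  rw [Prod.mk_add_mk, Prod.mk_eq_zero] at hxy
  rw [AddMonoidHom.coprod_apply] at h
  rcases hf x hxy.1 with rfl | hx <;> rcases hg y hxy.2 with rfl | hy
  · rfl
  · simp [hy, hv] at h
  · simp [hx, hu] at h
  · simp [hx, hy, huv] at h

theorem cyc_involution {A : Type*} [AddCommGroup A] {n : ℕ} {c : A} (h : 2 ^ (n + 1) • c = 0)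
    (x : ZMod (2 ^ (n + 1))) (hx : x + x = 0) : x = 0 ∨ cyc h x = 2 ^ n • c := by
  refine (zmod_two_pow_involution x hx).imp_right fun h' => ?_
  have := cyc_intCast h (2 ^ n)
  push_cast at this h'
  rw [h', this]
  exact_mod_cast natCast_zsmul c (2 ^ n)

theorem cyc_two_eq {A : Type*} [AddCommGroup A] {c : A} (h : 2 • c = 0)
    (x : ZMod 2) : x = 0 ∨ x = 1 ∧ cyc h x = c := by
  have h1 : cyc h 1 = c := by simpa using cyc_intCast h 1
  fin_cases x
  · exact Or.inl rfl
  · exact Or.inr ⟨rfl, h1⟩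

theorem cyc_one {A : Type*} [AddCommGroup A] {N : ℕ} {c : A} (h : N • c = 0) : cyc h 1 = c := by
  simpa using cyc_intCast h 1

theorem injective_cyc {A : Type*} [AddCommGroup A] {n : ℕ} {c : A} (h : 2 ^ (n + 1) • c = 0)
    (hc : 2 ^ n • c ≠ 0) : Function.Injective (cyc h) := by
  refine injective_of_involutions ⟨_, card_zmod_two_pow _⟩ _ fun x hx hx' => ?_
  exact (cyc_involution h x hx).resolve_right fun h' => hc (h'.symm.trans hx')

/-! ### Planes spanned by an involution and its image -/

section Flip

variable {A : Type*} [AddCommGroup A] {q : A → Circle} {θ : A ≃+ A} {x : A}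

/-- The homomorphism `(ℤ/2)² → A` with values `x` and `θ x` on the standard basis. -/
def flipHom (θ : A ≃+ A) (hx : x + x = 0) : ZMod 2 × ZMod 2 →+ A :=
  (cyc (N := 2) (by rw [two_nsmul, hx])).coprod
    (cyc (N := 2) (c := θ x) (by rw [two_nsmul, ← map_add, hx, map_zero]))

theorem flipHom_apply (hx : x + x = 0) (p : ZMod 2 × ZMod 2) :
    flipHom θ hx p = (p.1.val : ℤ) • x + (p.2.val : ℤ) • θ x := by
  rw [flipHom, AddMonoidHom.coprod_apply, cyc_apply, cyc_apply]

theorem flipHom_one_zero (hx : x + x = 0) : flipHom θ hx (1, 0) = x := by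
  simp [flipHom, cyc_one]

theorem flipHom_zero_one (hx : x + x = 0) : flipHom θ hx (0, 1) = θ x := by
  simp [flipHom, cyc_one]

theorem flipHom_one_one (hx : x + x = 0) : flipHom θ hx (1, 1) = x + θ x := by
  simp [flipHom, cyc_one]

theorem map_flipHom (M : IsInvolutiveMetricGroup q θ) (hx : x + x = 0) (y z : ZMod 2) :
    θ (flipHom θ hx (y, z)) = flipHom θ hx (z, y) := by
  rw [flipHom_apply, flipHom_apply, map_add, map_zsmul, map_zsmul, M.involutive, add_comm]

theorem polar_flipHom (M : IsInvolutiveMetricGroup q θ) (hx : x + x = 0) {w : A}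
    (h : polar q w x = 1) (h' : polar q w (θ x) = 1) (p : ZMod 2 × ZMod 2) :
    polar q w (flipHom θ hx p) = 1 := by
  rw [flipHom_apply, M.quad.polar_add_right, M.quad.polar_zsmul_right, M.quad.polar_zsmul_right,
    h, h', one_zpow, one_zpow, one_mul]

/-- Both x and θx pair to -1 with the trace, and the trace pairs to -1 with x, so no nonzero vector
is in the radical. Symmetry is invariance of q under θ. -/
theorem isFlipForm_flipHom (M : IsInvolutiveMetricGroup q θ) (hx : x + x = 0)
    (h : polar q x (x + θ x) = -1) : IsFlipForm fun p => q (flipHom θ hx p) := by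
  have h' : polar q (θ x) (x + θ x) = -1 := by rw [M.polar_map_left, M.map_add_map, h]
  refine ⟨⟨M.quad.comp _, ?_⟩, fun y z => by
    dsimp only
    rw [← M.preserves, map_flipHom M]⟩
  rintro ⟨y, z⟩ hp
  simp only [IsQuadraticForm.polar_comp] at hp
  have h11 := hp (1, 1)
  have h10 := hp (1, 0)
  fin_cases y <;> fin_cases z
  · rfl
  · exfalso
    change polar q (flipHom θ hx (0, 1)) (flipHom θ hx (1, 1)) = 1 at h11
    rw [flipHom_zero_one, flipHom_one_one, h'] at h11
    exact circle_neg_one_ne_one h11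
  · exfalso
    change polar q (flipHom θ hx (1, 0)) (flipHom θ hx (1, 1)) = 1 at h11
    rw [flipHom_one_zero, flipHom_one_one, h] at h11
    exact circle_neg_one_ne_one h11
  · exfalso
    change polar q (flipHom θ hx (1, 1)) (flipHom θ hx (1, 0)) = 1 at h10
    rw [flipHom_one_zero, flipHom_one_one, IsQuadraticForm.polar_comm, h] at h10
    exact circle_neg_one_ne_one h10

end Flip

/-! ### Summands with a single nonzero fixed point -/

/-- Meant for D the complement of a split-off summand. A moved involution of D has trace d and, by
`H₁`, pairs to -1 with d; this is the flip alternative and forces q(d) = -1. Otherwise d is the only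
nonzero involution of D, so an element c pairing to -1 with d has d as its last nonzero multiple by
a power of two. -/
theorem exists_flip_or_cyclic {A : Type*} [AddCommGroup A] {q : A → Circle} {θ : A ≃+ A}
    (M : IsInvolutiveMetricGroup q θ) (h2 : ∃ k : ℕ, Nat.card A = 2 ^ k) (D : AddSubgroup A)
    (hDθ : ∀ x ∈ D, θ x ∈ D) {d : A} (hd : d + d = 0)
    (hqd : q d ^ 2 = 1) (hV : ∀ x ∈ D, θ x = x → x = 0 ∨ x = d)
    (H₁ : ∀ x ∈ D, x + x = 0 → polar q x d = 1 → θ x = x) (H₂ : ∃ c ∈ D, polar q c d = -1) :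
    (∃ x ∈ D, x + x = 0 ∧ x + θ x = d ∧ polar q x d = -1 ∧ q d = -1) ∨
    (∃ c ∈ D, ∃ k : ℕ, 1 ≤ k ∧ 2 ^ k • c = d ∧ q c ^ (2 ^ (k + 1)) = -1 ∧ polar q c d = -1 ∧
      θ c = -c ∧ (q d = 1 → 2 ≤ k) ∧ (q d = -1 → k = 1)) := by
  by_cases hx : ∃ x ∈ D, x + x = 0 ∧ θ x ≠ x
  · obtain ⟨x, hxD, hxx, hθx⟩ := hx
    left
    have hxd : x + θ x = d := by
      refine (hV _ (D.add_mem hxD (hDθ x hxD)) (M.map_add_map x)).resolve_left fun h => hθx ?_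
      rw [← neg_eq_of_add_eq_zero_right h, neg_eq_self hxx]
    have hB : polar q x d = -1 :=
      (M.polar_eq_or hd x).resolve_left fun h => hθx (H₁ x hxD hxx h)
    refine ⟨x, hxD, hxx, hxd, hB, ?_⟩
    rw [← hxd, M.form_add_map, IsQuadraticForm.polar_comm, hxd, hB]
  · right
    push Not at hx
    obtain ⟨c, hcD, hc⟩ := H₂
    have hc0 : c ≠ 0 := by
      rintro rfl
      rw [M.quad.polar_zero_left] at hc
      exact circle_neg_one_ne_one hc.symm
    obtain ⟨k, hk, hk'⟩ := exists_pow_smul_ne_zero h2 hc0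
    have hkd : 2 ^ k • c = d := by
      have hmem : 2 ^ k • c ∈ D := D.nsmul_mem hcD _
      refine (hV _ hmem (hx _ hmem ?_)).resolve_left hk
      rw [← two_nsmul, ← mul_nsmul, ← pow_succ, hk']
    have hqc : q c ^ (2 ^ (k + 1)) = -1 := by
      rw [pow_succ', pow_mul, ← M.quad.polar_self, ← M.quad.polar_nsmul_right, hkd, hc]
    have hk1 : 1 ≤ k := by
      rw [Nat.one_le_iff_ne_zero]
      rintro rfl
      rw [zero_add, pow_one] at hqc
      rw [pow_zero, one_nsmul] at hkd
      rw [← hkd, hqc] at hqd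
      exact circle_neg_one_ne_one hqd
    -- Here 4^k is split so that q(d) = (-1)^(2^(k-1)), which is -1 exactly when k = 1.
    have hqdk : q d = q c ^ (2 ^ (k + 1) * 2 ^ (k - 1)) := by
      rw [← hkd, M.quad.map_nsmul, ← pow_mul, ← pow_add]
      congr 2; omega
    rw [pow_mul, hqc] at hqdk
    have hk2 : q d = 1 → 2 ≤ k := by
      intro h
      by_contra hlt
      obtain rfl : k = 1 := by omega
      rw [h] at hqdk
      simp only [Nat.sub_self, pow_zero, pow_one] at hqdk
      exact circle_neg_one_ne_one hqdk.symm
    have hk3 : q d = -1 → k = 1 := by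
      intro h
      by_contra hlt
      obtain ⟨l, rfl⟩ : ∃ l, k = l + 2 := ⟨k - 2, by omega⟩
      rw [h, show l + 2 - 1 = l + 1 by omega, pow_succ', pow_mul] at hqdk
      rw [neg_one_sq, one_pow] at hqdk
      exact circle_neg_one_ne_one hqdk
    refine ⟨c, hcD, k, hk1, hkd, hqc, hc, ?_, hk2, hk3⟩
    -- Trace d would give q(d) = ⟨d, c⟩ = -1, so k = 1 and c + θc = 2c. Then c is fixed, hence
    -- killed by two, against 2c = d ≠ 0.
    rcases hV _ (D.add_mem hcD (hDθ c hcD)) (M.map_add_map c) with h | h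
    · exact eq_neg_of_add_eq_zero_right h
    · exfalso
      have hq := M.form_add_map c
      rw [h, IsQuadraticForm.polar_comm, hc] at hq
      obtain rfl := hk3 hq
      have hfix : θ c = c := by
        rw [← hkd, pow_one, two_nsmul] at h
        exact add_left_cancel h
      rcases hV c hcD hfix with h' | h'
      · exact hc0 h'
      · rw [pow_one, two_nsmul, h', hd] at hkd
        exact hc0 (h'.trans hkd.symm)


section

variable {A : Type*} [AddCommGroup A] {q : A → Circle} {θ : A ≃+ A}

/-- The elements orthogonal to both `x` and `y`. -/
def IsQuadraticForm.perpPair (Q : IsQuadraticForm q) (x y : A) : AddSubgroup A where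
  carrier := {z | polar q z x = 1 ∧ polar q z y = 1}
  zero_mem' := ⟨Q.polar_zero_left x, Q.polar_zero_left y⟩
  add_mem' := by
    rintro a b ⟨ha, ha'⟩ ⟨hb, hb'⟩
    exact ⟨by rw [Q.polar_add_left, ha, hb, one_mul], by rw [Q.polar_add_left, ha', hb', one_mul]⟩
  neg_mem' := by
    rintro a ⟨ha, ha'⟩
    exact ⟨by rw [Q.polar_neg_left, ha, inv_one], by rw [Q.polar_neg_left, ha', inv_one]⟩

theorem IsQuadraticForm.mem_perpPair (Q : IsQuadraticForm q) {x y z : A} :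
    z ∈ Q.perpPair x y ↔ polar q z x = 1 ∧ polar q z y = 1 := Iff.rfl

/-! ### Nondegenerate fixed subgroups -/

/-- By `hnd` no nonzero fixed point is orthogonal to u and v, so u and v already generate A. On this
elementary abelian group the identity and -1 coincide. -/
theorem isIso_of_klein_nondegenerate (M : IsInvolutiveMetricGroup q θ)
    (h2 : ∃ k : ℕ, Nat.card A = 2 ^ k) {u v : A} (K : IsKlein θ u v)
    (hnd : ∀ y, θ y = y → polar q y u = 1 → polar q y v = 1 → y = 0)
    {q' : ZMod 2 × ZMod 2 → Circle}
    (hq' : ∀ x y : ZMod 2, q u ^ ((x.val : ℤ) ^ 2) * q v ^ ((y.val : ℤ) ^ 2) *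
      polar q u v ^ ((x.val : ℤ) * y.val) = q' (x, y)) :
    IsIso q θ q' (fun p => -p) := by
  have hu : 2 • u = 0 := by rw [two_nsmul, K.add_self_left]
  have hv : 2 • v = 0 := by rw [two_nsmul, K.add_self_right]
  have hfu : (cyc hu).coprod (cyc hv) (1, 0) = u := by simp [cyc_one]
  have hfv : (cyc hu).coprod (cyc hv) (0, 1) = v := by simp [cyc_one]
  refine isIso_of_hom ((cyc hu).coprod (cyc hv)) ?_ ?_ ?_ ?_
  · refine injective_coprod_of_involutions ⟨1, by simp⟩ ⟨1, by simp⟩ _ _ (u := u) (v := v)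
      (fun x _ => (cyc_two_eq hu x).imp_right And.right)
      (fun x _ => (cyc_two_eq hv x).imp_right And.right) K.left_ne K.right_ne K.add_ne_zero
  · refine M.surjective_of_klein h2 K _ ⟨(1, 0), hfu⟩ ⟨(0, 1), hfv⟩ fun y hy h => ?_
    refine hnd y hy ?_ ?_
    · rw [← hfu, h]
    · rw [← hfv, h]
  · rintro ⟨x, y⟩
    rw [AddMonoidHom.coprod_apply, cyc_apply, cyc_apply, M.quad.map_zsmul_add_zsmul, hq']
  · rintro ⟨x, y⟩
    rw [map_neg, AddMonoidHom.coprod_apply, cyc_apply, cyc_apply, map_add, map_zsmul, map_zsmul,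
      K.map_left, K.map_right, neg_add, ← smul_neg, ← smul_neg, neg_eq_self K.add_self_left,
      neg_eq_self K.add_self_right]

/-! ### Splitting off a line -/

/-- Since ⟨a, a⟩ = q(a)² = -1, the line through a is an orthogonal summand, and d is the only
nonzero fixed point of its complement. The value q(d) is carried along because it decides the
alternative or bounds the order of the cyclic summand. -/
theorem classify_of_line (M : IsInvolutiveMetricGroup q θ)
    (h2 : ∃ k : ℕ, Nat.card A = 2 ^ k) {d a : A} (K : IsKlein θ d a) (hd : q d ^ 2 = 1)
    (ha : q a ^ 2 = -1) (hda : polar q d a = 1) {r : ℤ} (hr : q a = zeta (2 * 2) ^ r) :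
    (q d = -1 ∧ ∃ q' : ZMod 2 × ZMod 2 → Circle, IsFlipForm q' ∧
      IsIso q θ (prodForm (cyclicForm 2 r) q') (fun p => (p.1, p.2.2, p.2.1))) ∨
    (∃ (k : ℕ) (s : ℤ), Odd s ∧ (q d = 1 → 2 ≤ k) ∧ (q d = -1 → k = 1) ∧
      IsIso q θ (prodForm (cyclicForm 2 r) (cyclicForm (2 ^ (k + 1)) s)) (fun p => -p)) := by
  have Q := M.quad
  have haa : polar q a a = -1 := by rw [Q.polar_self, ha]
  have had : polar q a d = 1 := by rw [IsQuadraticForm.polar_comm, hda]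
  have h2a : 2 • a = 0 := by rw [two_nsmul, K.add_self_right]
  -- With both arguments equal, `perpPair a a` is simply the complement of a.
  have hθD : ∀ x ∈ Q.perpPair a a, θ x ∈ Q.perpPair a a := by
    intro x hx
    rw [Q.mem_perpPair] at hx ⊢
    rwa [M.polar_map_left, K.map_right]
  have hV : ∀ x ∈ Q.perpPair a a, θ x = x → x = 0 ∨ x = d := by
    intro x hx hθx
    rcases K.mem x hθx with rfl | rfl | rfl | rfl
    · exact Or.inl rfl
    · exact Or.inr rfl
    · exact absurd (haa.symm.trans hx.1) circle_neg_one_ne_one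
    · have := hx.1
      rw [Q.polar_add_left, hda, haa, one_mul] at this
      exact absurd this circle_neg_one_ne_one
  have H₁ : ∀ x ∈ Q.perpPair a a, x + x = 0 → polar q x d = 1 → θ x = x :=
    fun x hx hxx hxd => M.map_eq_self_of_klein K hxx hxd hx.1
  have H₂ : ∃ c ∈ Q.perpPair a a, polar q c d = -1 := by
    obtain ⟨c, hc⟩ := M.exists_polar_eq_neg_one K.left_ne K.add_self_left
    rcases M.polar_eq_or K.add_self_right c with h | h
    · exact ⟨c, ⟨h, h⟩, hc⟩
    -- Adding a moves c into the complement of a and keeps its pairing with d, because ⟨a, d⟩ = 1.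
    · have : polar q (c + a) a = 1 := by rw [Q.polar_add_left, h, haa]; simp
      exact ⟨c + a, ⟨this, this⟩, by rw [Q.polar_add_left, hc, had, mul_one]⟩
  have hcyca : Function.Injective (cyc h2a) :=
    injective_cyc (n := 0) h2a (by simpa using K.right_ne)
  rcases exists_flip_or_cyclic M h2 _ hθD K.add_self_left hd hV H₁ H₂ with
    ⟨x, hxD, hxx, hxd, hB, hqd⟩ | ⟨c, hcD, k, hk1, hkd, hqc, hcd, hθc, hk2, hk3⟩
  · left
    have hax : polar q a x = 1 := by rw [IsQuadraticForm.polar_comm, hxD.1]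
    have haθ : polar q a (θ x) = 1 := by rw [← M.polar_map_left, K.map_right, hax]
    have hflip := isFlipForm_flipHom M hxx (by rw [hxd, hB])
    have horth : ∀ (y : ZMod 2) (p : ZMod 2 × ZMod 2),
        polar q (cyc h2a y) (flipHom θ hxx p) = 1 := by
      intro y p
      rw [cyc_apply, Q.polar_zsmul_left, polar_flipHom M hxx hax haθ, one_zpow]
    refine ⟨hqd, _, hflip, isIso_of_hom ((cyc h2a).coprod (flipHom θ hxx)) ?_ ?_ ?_ ?_⟩
    -- The flip plane is the factor already known to be nondegenerate, so it is put first and the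
    -- factors are swapped back.
    · have := injective_coprod_of_polar Q (flipHom θ hxx) (cyc h2a)
        (fun x y => by rw [IsQuadraticForm.polar_comm, horth]) hflip.1 hcyca
      have hswap : ⇑((cyc h2a).coprod (flipHom θ hxx)) =
          ⇑((flipHom θ hxx).coprod (cyc h2a)) ∘ Prod.swap := by
        ext p
        simp [add_comm]
      rw [hswap]
      exact this.comp Prod.swap_injective
    · refine M.surjective_of_klein h2 K _ ⟨(0, (1, 1)), ?_⟩ ⟨(1, 0), ?_⟩ fun y hy h => ?_
      · rw [AddMonoidHom.coprod_apply, map_zero, zero_add, flipHom_one_one, hxd]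
      · rw [AddMonoidHom.coprod_apply, map_zero, add_zero, cyc_one]
      · have h₁ := h (1, 0)
        rw [AddMonoidHom.coprod_apply, map_zero, add_zero, cyc_one] at h₁
        refine (hV y ⟨h₁, h₁⟩ hy).resolve_right ?_
        rintro rfl
        have h₂ := h (0, (1, 0))
        rw [AddMonoidHom.coprod_apply, map_zero, zero_add, flipHom_one_zero,
          IsQuadraticForm.polar_comm, hB] at h₂
        exact circle_neg_one_ne_one h₂
    · intro p
      rw [form_coprod _ _ horth, form_cyc Q h2a hr, prodForm]
    · rintro ⟨x, y, z⟩
      rw [AddMonoidHom.coprod_apply, AddMonoidHom.coprod_apply, map_add, map_flipHom M, cyc_apply,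
        map_zsmul, K.map_right]
  · right
    obtain ⟨s, hs, hsc⟩ := exists_odd_zeta_zpow (by positivity) hqc
    have hck : 2 ^ (k + 1) • c = 0 := by
      rw [pow_succ, mul_nsmul, hkd, two_nsmul, K.add_self_left]
    have hac : polar q a c = 1 := by rw [IsQuadraticForm.polar_comm, hcD.1]
    refine ⟨k, s, hs, hk2, hk3, isIso_of_hom ((cyc h2a).coprod (cyc hck)) ?_ ?_ ?_ ?_⟩
    · refine injective_coprod_of_involutions ⟨1, by simp⟩ ⟨_, card_zmod_two_pow _⟩ _ _ (u := a)
        (v := d) (fun x _ => (cyc_two_eq h2a x).imp_right And.right)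
        (fun x hx => ?_) K.right_ne K.left_ne K.symm.add_ne_zero
      rw [← hkd]
      exact cyc_involution hck x hx
    · refine M.surjective_of_klein h2 K _ ⟨(0, ((2 ^ k : ℕ) : ℤ)), ?_⟩ ⟨(1, 0), ?_⟩
        fun y hy h => ?_
      · rw [AddMonoidHom.coprod_apply, map_zero, zero_add, cyc_intCast, natCast_zsmul, hkd]
      · rw [AddMonoidHom.coprod_apply, map_zero, add_zero, cyc_one]
      · have h₁ := h (1, 0)
        rw [AddMonoidHom.coprod_apply, map_zero, add_zero, cyc_one] at h₁
        refine (hV y ⟨h₁, h₁⟩ hy).resolve_right ?_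
        rintro rfl
        have h₂ := h (0, 1)
        rw [AddMonoidHom.coprod_apply, map_zero, zero_add, cyc_one,
          IsQuadraticForm.polar_comm, hcd] at h₂
        exact circle_neg_one_ne_one h₂
    · intro p
      rw [form_coprod _ _ (polar_cyc_cyc Q h2a hck hac), form_cyc Q h2a hr, form_cyc Q hck hsc,
        prodForm]
    · rintro ⟨x, y⟩
      rw [map_neg, AddMonoidHom.coprod_apply, cyc_apply, cyc_apply, map_add, map_zsmul, map_zsmul,
        K.map_right, hθc, neg_add, smul_neg]
      rw [← smul_neg (x.val : ℤ) a, neg_eq_self K.add_self_right]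

/-! ### Splitting off a flip form -/

/-- The plane spanned by x and θx is nondegenerate, so it splits off. Its complement is
automatically orthogonal to v = x + θx and contains just one nonzero fixed point, so the
flip-or-cyclic dichotomy applies to it. -/
theorem classify_of_flip (M : IsInvolutiveMetricGroup q θ)
    (h2 : ∃ k : ℕ, Nat.card A = 2 ^ k) {u v x : A} (K : IsKlein θ u v) (huu : polar q u u = 1)
    (hvv : polar q v v = 1) (huv : polar q u v = 1) (hxx : x + x = 0) (hxv : x + θ x = v)
    (hB : polar q x v = -1) :
    (∃ (n : ℕ) (r : ℤ) (q' : ZMod 2 × ZMod 2 → Circle), 2 ≤ n ∧ Odd r ∧ IsFlipForm q' ∧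
      IsIso q θ (fun p : ZMod 2 × ZMod 2 × ZMod (2 ^ n) =>
          q' (p.1, p.2.1) * cyclicForm (2 ^ n) r p.2.2) (fun p => (p.2.1, p.1, -p.2.2))) ∨
    (∃ q' q'' : ZMod 2 × ZMod 2 → Circle, IsFlipForm q' ∧ IsFlipForm q'' ∧
      IsIso q θ (fun p : ZMod 2 × ZMod 2 × ZMod 2 × ZMod 2 =>
          q' (p.1, p.2.2.1) * q'' (p.2.1, p.2.2.2)) swapFour) := by
  have Q := M.quad
  -- the other generator may be taken orthogonal to the flip form
  obtain ⟨d, K, hdd, hdv, hdx⟩ : ∃ d, IsKlein θ d v ∧ polar q d d = 1 ∧ polar q d v = 1 ∧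
      polar q d x = 1 := by
    rcases M.polar_eq_or K.add_self_left x with h | h
    · exact ⟨u, K, huu, huv, by rw [IsQuadraticForm.polar_comm, h]⟩
    · refine ⟨v + u, K.symm.add_right.symm, ?_, ?_, ?_⟩
      · simp [Q.polar_add_left, Q.polar_add_right, huu, hvv, huv, IsQuadraticForm.polar_comm q v u]
      · simp [Q.polar_add_left, hvv, huv]
      · rw [IsQuadraticForm.polar_comm, Q.polar_add_right, hB, h]; simp
  have hxd : polar q x d = 1 := by rw [IsQuadraticForm.polar_comm, hdx]
  have hd2 : q d ^ 2 = 1 := by rw [← Q.polar_self, hdd]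
  have hθθ : θ x + θ x = 0 := by rw [← map_add, hxx, map_zero]
  have hBθ : polar q (θ x) v = -1 := by rw [M.polar_map_left, K.map_right, hB]
  have hflip := isFlipForm_flipHom M hxx (by rw [hxv, hB])
  set D := Q.perpPair x (θ x) with hD
  have hmem : ∀ {z}, z ∈ D ↔ polar q z x = 1 ∧ polar q z (θ x) = 1 := Q.mem_perpPair
  have hθD : ∀ z ∈ D, θ z ∈ D := by
    intro z hz
    rw [hmem] at hz ⊢
    rw [M.polar_map_left, M.polar_map_map]
    exact ⟨hz.2, hz.1⟩
  have hDv : ∀ z ∈ D, polar q z v = 1 := by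
    intro z hz
    rw [← hxv, Q.polar_add_right, hz.1, hz.2, one_mul]
  have hV : ∀ z ∈ D, θ z = z → z = 0 ∨ z = d := by
    intro z hz hθz
    have hzx := hz.1
    rcases K.mem z hθz with rfl | rfl | rfl | rfl
    · exact Or.inl rfl
    · exact Or.inr rfl
    · rw [IsQuadraticForm.polar_comm, hB] at hzx
      exact absurd hzx circle_neg_one_ne_one
    · rw [Q.polar_add_left, hdx, one_mul, IsQuadraticForm.polar_comm, hB] at hzx
      exact absurd hzx circle_neg_one_ne_one
  have hdD : d ∈ D := hmem.2 ⟨hdx, by rw [← M.polar_map_left, K.map_left, hdx]⟩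
  have H₁ : ∀ z ∈ D, z + z = 0 → polar q z d = 1 → θ z = z :=
    fun z hz hzz hzd => M.map_eq_self_of_klein K hzz hzd (hDv z hz)
  have hθd : polar q (θ x) d = 1 := by rw [M.polar_map_left, K.map_left, hxd]
  have H₂ : ∃ c ∈ D, polar q c d = -1 := by
    obtain ⟨c, hc⟩ := M.exists_polar_eq_neg_one K.left_ne K.add_self_left
    have hs : polar q (θ x) (θ x) = polar q x x := M.polar_map_map x x
    have ht : polar q (θ x) x = polar q x (θ x) := IsQuadraticForm.polar_comm _ _ _
    have hst : polar q x x * polar q x (θ x) = -1 := by rw [← Q.polar_add_right, hxv, hB]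
    -- As ⟨x, x⟩⟨x, θx⟩ = -1, exactly one factor is -1. So x and θx, in one order or the other, form
    -- their own dual basis, which is used to project c onto D.
    obtain ⟨e₁, e₂, h₁₁, h₁₂, h₂₁, h₂₂, h₁d, h₂d⟩ : ∃ e₁ e₂, polar q e₁ x = -1 ∧
        polar q e₁ (θ x) = 1 ∧ polar q e₂ x = 1 ∧ polar q e₂ (θ x) = -1 ∧
        polar q e₁ d = 1 ∧ polar q e₂ d = 1 := by
      rcases M.polar_eq_or hxx x with h | h <;> rw [h] at hst hs
      · rw [one_mul] at hst
        exact ⟨θ x, x, by rw [ht, hst], hs, h, hst, hθd, hxd⟩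
      · rw [neg_mul, neg_inj, one_mul] at hst
        exact ⟨x, θ x, h, hst, by rw [ht, hst], hs, hxd, hθd⟩
    obtain ⟨c', hc', hc'x⟩ : ∃ c', polar q c' d = -1 ∧ polar q c' x = 1 := by
      rcases M.polar_eq_or hxx c with h | h
      · exact ⟨c, hc, h⟩
      · exact ⟨c + e₁, by rw [Q.polar_add_left, hc, h₁d, mul_one],
          by rw [Q.polar_add_left, h, h₁₁, neg_mul_neg, one_mul]⟩
    rcases M.polar_eq_or hθθ c' with h | h
    · exact ⟨c', hmem.2 ⟨hc'x, h⟩, hc'⟩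
    · exact ⟨c' + e₂, hmem.2 ⟨by rw [Q.polar_add_left, hc'x, h₂₁, one_mul],
        by rw [Q.polar_add_left, h, h₂₂, neg_mul_neg, one_mul]⟩,
        by rw [Q.polar_add_left, hc', h₂d, mul_one]⟩
  have hperp : ∀ c ∈ D, ∀ p, polar q (flipHom θ hxx p) c = 1 := fun c hc p => by
    rw [IsQuadraticForm.polar_comm, polar_flipHom M hxx hc.1 hc.2]
  rcases exists_flip_or_cyclic M h2 D hθD K.add_self_left hd2 hV H₁ H₂ with
    ⟨x', hxD', hxx', hxd', hB', hqd⟩ | ⟨c, hcD, k, hk1, hkd, hqc, hcd, hθc, -, -⟩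
  · right
    have hflip' := isFlipForm_flipHom M hxx' (by rw [hxd', hB'])
    have horth : ∀ (p p' : ZMod 2 × ZMod 2),
        polar q (flipHom θ hxx p) (flipHom θ hxx' p') = 1 := fun p p' =>
      polar_flipHom M hxx' (hperp _ hxD' p) (hperp _ (hθD _ hxD') p) p'
    let e : (ZMod 2 × ZMod 2) × (ZMod 2 × ZMod 2) ≃+ ZMod 2 × ZMod 2 × ZMod 2 × ZMod 2 :=
      { toFun := fun p => (p.1.1, p.2.1, p.1.2, p.2.2)
        invFun := fun p => ((p.1, p.2.2.1), (p.2.1, p.2.2.2))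
        left_inv := fun _ => rfl
        right_inv := fun _ => rfl
        map_add' := fun _ _ => rfl }
    refine ⟨_, _, hflip, hflip', IsIso.congr (q' := fun p => q (flipHom θ hxx p.1) *
        q (flipHom θ hxx' p.2)) (θ' := fun p => (p.1.swap, p.2.swap))
      (isIso_of_hom ((flipHom θ hxx).coprod (flipHom θ hxx')) ?_ ?_ ?_ ?_) e
      (fun _ => rfl) (fun _ => rfl)⟩
    · refine injective_coprod_of_polar Q _ _ horth hflip.1 ?_
      rw [injective_iff_map_eq_zero]
      intro p hp
      refine hflip'.1.nondegenerate p fun p' => ?_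
      rw [IsQuadraticForm.polar_comp, hp, Q.polar_zero_left]
    · refine M.surjective_of_klein h2 K _ ⟨(0, (1, 1)), ?_⟩ ⟨((1, 1), 0), ?_⟩ fun y hy h => ?_
      · rw [AddMonoidHom.coprod_apply, map_zero, zero_add, flipHom_one_one, hxd']
      · rw [AddMonoidHom.coprod_apply, map_zero, add_zero, flipHom_one_one, hxv]
      · have h₁ := h ((1, 0), 0)
        have h₂ := h ((0, 1), 0)
        have h₃ := h (0, (1, 0))
        rw [AddMonoidHom.coprod_apply, map_zero, add_zero, flipHom_one_zero] at h₁
        rw [AddMonoidHom.coprod_apply, map_zero, add_zero, flipHom_zero_one] at h₂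
        rw [AddMonoidHom.coprod_apply, map_zero, zero_add, flipHom_one_zero] at h₃
        refine (hV y (hmem.2 ⟨h₁, h₂⟩) hy).resolve_right ?_
        rintro rfl
        rw [IsQuadraticForm.polar_comm, hB'] at h₃
        exact circle_neg_one_ne_one h₃
    · exact form_coprod _ _ horth
    · rintro ⟨⟨x, y⟩, z, w⟩
      rw [AddMonoidHom.coprod_apply, AddMonoidHom.coprod_apply, map_add, map_flipHom M,
        map_flipHom M]
      rfl
  · left
    obtain ⟨s, hs, hsc⟩ := exists_odd_zeta_zpow (by positivity) hqc
    have hck : 2 ^ (k + 1) • c = 0 := by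
      rw [pow_succ, mul_nsmul, hkd, two_nsmul, K.add_self_left]
    have horth : ∀ (p : ZMod 2 × ZMod 2) (y : ZMod (2 ^ (k + 1))),
        polar q (flipHom θ hxx p) (cyc hck y) = 1 := by
      intro p y
      rw [cyc_apply, Q.polar_zsmul_right, hperp c hcD, one_zpow]
    let e : (ZMod 2 × ZMod 2) × ZMod (2 ^ (k + 1)) ≃+ ZMod 2 × ZMod 2 × ZMod (2 ^ (k + 1)) :=
      AddEquiv.prodAssoc
    refine ⟨k + 1, s, _, by omega, hs, hflip, IsIso.congr (q' := fun p => q (flipHom θ hxx p.1) *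
        cyclicForm (2 ^ (k + 1)) s p.2) (θ' := fun p => (p.1.swap, -p.2))
      (isIso_of_hom ((flipHom θ hxx).coprod (cyc hck)) ?_ ?_ ?_ ?_) e
      (fun _ => rfl) (fun _ => rfl)⟩
    · refine injective_coprod_of_polar Q _ _ horth hflip.1 (injective_cyc hck ?_)
      rw [hkd]; exact K.left_ne
    · refine M.surjective_of_klein h2 K _ ⟨(0, ((2 ^ k : ℕ) : ℤ)), ?_⟩ ⟨((1, 1), 0), ?_⟩
        fun y hy h => ?_
      · rw [AddMonoidHom.coprod_apply, map_zero, zero_add, cyc_intCast, natCast_zsmul, hkd]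
      · rw [AddMonoidHom.coprod_apply, map_zero, add_zero, flipHom_one_one, hxv]
      · have h₁ := h ((1, 0), 0)
        have h₂ := h ((0, 1), 0)
        have h₃ := h (0, 1)
        rw [AddMonoidHom.coprod_apply, map_zero, add_zero, flipHom_one_zero] at h₁
        rw [AddMonoidHom.coprod_apply, map_zero, add_zero, flipHom_zero_one] at h₂
        rw [AddMonoidHom.coprod_apply, map_zero, zero_add, cyc_one] at h₃
        refine (hV y (hmem.2 ⟨h₁, h₂⟩) hy).resolve_right ?_
        rintro rfl
        rw [IsQuadraticForm.polar_comm, hcd] at h₃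
        exact circle_neg_one_ne_one h₃
    · intro p
      rw [form_coprod _ _ horth, form_cyc Q hck hsc]
    · rintro ⟨⟨x, y⟩, z⟩
      rw [AddMonoidHom.coprod_apply, AddMonoidHom.coprod_apply, map_add, map_flipHom M, map_neg,
        cyc_apply, map_zsmul, hθc, smul_neg]
      rfl

end


section

variable {A : Type*} [AddCommGroup A] {q : A → Circle} {θ : A ≃+ A}

/-! ### Involutions that are not fixed -/

/-- Under these hypotheses v is orthogonal to every involution, and one can even write v = 2y with y
orthogonal to all fixed points. Then θy = -y, so x + y is fixed; but its double is v ≠ 0, whereas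
fixed points are killed by two. -/
theorem false_of_unique_trace (M : IsInvolutiveMetricGroup q θ) {w v x : A} (K : IsKlein θ w v)
    (hvv : polar q v v = 1) (hvw : polar q v w = 1) (hqv : q v = 1) (hxx : x + x = 0)
    (hxv : x + θ x = v) (hall : ∀ y, y + y = 0 → θ y = y ∨ y + θ y = v) : False := by
  have := M.finite
  have Q := M.quad
  have hvx : polar q v x = 1 := by rw [← hxv, ← M.form_add_map, hxv, hqv]
  have hxv' : polar q x v = 1 := by rw [IsQuadraticForm.polar_comm, hvx]
  have hxw : polar q x w = -1 := by
    refine (M.polar_eq_or K.add_self_left x).resolve_left fun h => K.right_ne ?_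
    rw [← hxv, M.map_eq_self_of_klein K hxx h hxv', hxx]
  have hfix : ∀ y, θ y = y → polar q v y = 1 := by
    intro y hy
    rcases K.mem y hy with rfl | rfl | rfl | rfl
    · exact Q.polar_zero_right v
    · exact hvw
    · exact hvv
    · rw [Q.polar_add_right, hvw, hvv, one_mul]
  have htor : ∀ y, y + y = 0 → polar q v y = 1 := by
    intro y hy
    rcases hall y hy with h | h
    · exact hfix y h
    · have hyx : θ (y - x) = y - x := by
        have h₁ : θ y = v - y := by rw [← h]; abel
        have h₂ : θ x = v - x := by rw [← hxv]; abel
        rw [map_sub, h₁, h₂]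
        have h₃ : x - y = -x - -y := by rw [neg_eq_self hxx, neg_eq_self hy]
        calc v - y - (v - x) = x - y := by abel
          _ = y - x := by rw [h₃]; abel
      have := hfix _ hyx
      rwa [Q.polar_sub_right, hvx, inv_one, mul_one] at this
  -- Double orthogonality: if z is orthogonal to this image, 2z is a fixed point. Pairing with the
  -- involution x leaves 2z = 0 or 2z = v; in the latter case ⟨z, v⟩ = q(z)⁴ = q(2z) = q(v) = 1.
  have hv : v ∈ (Q.perpPair w v).map (nsmulAddMonoidHom 2) := by
    refine M.form.mem_of_perp_perp _ _ fun z hz => ?_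
    have hzz : z + z ∈ fixedSubgroup θ := by
      refine M.form.mem_of_perp_perp _ _ fun y hy => ?_
      have := hz _ ⟨y, ⟨hy w K.map_left, hy v K.map_right⟩, rfl⟩
      rw [nsmulAddMonoidHom_apply, two_nsmul, Q.polar_add_right, ← Q.polar_add_left] at this
      rw [IsQuadraticForm.polar_comm, this]
    have hxz : polar q x (z + z) = 1 := by
      rw [Q.polar_add_right, ← Q.polar_add_left, hxx, Q.polar_zero_left]
    rcases K.mem _ hzz with h | h | h | h
    · rw [IsQuadraticForm.polar_comm, htor z h]
    · rw [h, hxw] at hxz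
      exact absurd hxz circle_neg_one_ne_one
    · rw [← h, ← two_nsmul, Q.polar_nsmul_right, Q.polar_self, ← pow_mul]
      rw [← h, ← two_nsmul, Q.map_nsmul] at hqv
      exact hqv
    · rw [h, Q.polar_add_right, hxw, hxv', mul_one] at hxz
      exact absurd hxz circle_neg_one_ne_one
  obtain ⟨y, ⟨hyw, hyv⟩, hy⟩ := hv
  rw [nsmulAddMonoidHom_apply, two_nsmul] at hy
  have hθy := M.map_eq_neg_of_klein K hyw hyv
  have hfixed : θ (x + y) = x + y := by
    have h₂ : θ x = v - x := by rw [← hxv]; abel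
    rw [map_add, hθy, h₂, ← hy, sub_eq_add_neg, neg_eq_self hxx]
    abel
  have := K.add_self hfixed
  rw [add_add_add_comm, hxx, zero_add, hy] at this
  exact K.right_ne this

/-! ### Four-dimensional two-torsion -/

theorem trace_add_fixed {θ : A ≃+ A} {x g : A} (hg : θ g = g) (hgg : g + g = 0) :
    x + g + θ (x + g) = x + θ x := by
  rw [map_add, hg, add_add_add_comm, hgg, add_zero]

/-- An involution pairs trivially with its own trace, where q = 1. It must pair to -1 with the other
trace, since otherwise it would be fixed and its trace would vanish. -/
theorem polar_traces (M : IsInvolutiveMetricGroup q θ) (hq : ∀ g, θ g = g → q g = 1) {x y : A}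
    (hx : x + x = 0) (hy : y + y = 0) (K : IsKlein θ (x + θ x) (y + θ y)) :
    polar q x (x + θ x) = 1 ∧ polar q x (y + θ y) = -1 ∧ polar q y (x + θ x) = -1 ∧
      polar q y (y + θ y) = 1 := by
  have key : ∀ x y : A, x + x = 0 → IsKlein θ (x + θ x) (y + θ y) →
      polar q x (x + θ x) = 1 ∧ polar q x (y + θ y) = -1 := by
    intro x y hx K
    have hx1 : polar q x (x + θ x) = 1 := by
      rw [IsQuadraticForm.polar_comm, ← M.form_add_map, hq _ K.map_left]
    refine ⟨hx1, (M.polar_eq_or K.add_self_right x).resolve_left fun h => K.left_ne ?_⟩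
    rw [M.map_eq_self_of_klein K hx hx1 h, hx]
  exact ⟨(key x y hx K).1, (key x y hx K).2, (key y x hy K.symm).2, (key y x hy K.symm).1⟩

/-- With q(y) = ⟨x, y⟩ = 1, the pairings with the traces determine the whole Gram matrix of x, θx,
y, θy in terms of q(x) alone. Leaving q(x) free covers both models at once. -/
theorem isIso_cross (M : IsInvolutiveMetricGroup q θ) (h2 : ∃ k : ℕ, Nat.card A = 2 ^ k)
    (hq : ∀ g, θ g = g → q g = 1) {x y : A} (hx : x + x = 0) (hy : y + y = 0)
    (K : IsKlein θ (x + θ x) (y + θ y)) (hqy : q y = 1) (hxy : polar q x y = 1) :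
    IsIso q θ (fun p => crossForm p * q x ^ ((p.1.val + p.2.2.1.val) ^ 2)) swapFour := by
  have Q := M.quad
  obtain ⟨hxv, hxw, hyv, hyw⟩ := polar_traces M hq hx hy K
  -- Pairing with the trace of the other pair reads off the parity of the sum of the two
  -- coordinates.
  have hfx : ∀ (x v : A) (hx : x + x = 0) (p : ZMod 2 × ZMod 2), polar q x v = -1 → θ v = v →
      polar q (flipHom θ hx p) v = 1 → p = (0, 0) ∨ p = (1, 1) := by
    rintro x v hx ⟨a, b⟩ hxv hv h
    have hθ : polar q (θ x) v = -1 := by rw [M.polar_map_left, hv, hxv]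
    fin_cases a <;> fin_cases b
    · exact Or.inl rfl
    · change polar q (flipHom θ hx (0, 1)) v = 1 at h
      rw [flipHom_zero_one, hθ] at h
      exact absurd h circle_neg_one_ne_one
    · change polar q (flipHom θ hx (1, 0)) v = 1 at h
      rw [flipHom_one_zero, hxv] at h
      exact absurd h circle_neg_one_ne_one
    · exact Or.inr rfl
  have hpf : ∀ (x v : A) (hx : x + x = 0) (p : ZMod 2 × ZMod 2), polar q x v = 1 → θ v = v →
      polar q (flipHom θ hx p) v = 1 := fun x v hx p hxv hv => by
    rw [IsQuadraticForm.polar_comm]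
    rw [IsQuadraticForm.polar_comm] at hxv
    exact polar_flipHom M hx hxv (by rw [← M.polar_map_left, hv, hxv]) p
  let e : (ZMod 2 × ZMod 2) × (ZMod 2 × ZMod 2) ≃+ ZMod 2 × ZMod 2 × ZMod 2 × ZMod 2 :=
    { toFun := fun p => (p.1.1, p.2.1, p.1.2, p.2.2)
      invFun := fun p => ((p.1, p.2.2.1), (p.2.1, p.2.2.2))
      left_inv := fun _ => rfl
      right_inv := fun _ => rfl
      map_add' := fun _ _ => rfl }
  refine IsIso.congr (q' := fun p => crossForm (e p) * q x ^ ((p.1.1.val + p.1.2.val) ^ 2))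
    (θ' := fun p => (p.1.swap, p.2.swap))
    (isIso_of_hom ((flipHom θ hx).coprod (flipHom θ hy)) ?_ ?_ ?_ ?_) e
    (fun _ => rfl) (fun _ => rfl)
  · rw [injective_iff_map_eq_zero]
    rintro ⟨p, p'⟩ h
    rw [AddMonoidHom.coprod_apply] at h
    have h₁ := hfx x _ hx p hxw K.map_right (by
      rw [eq_neg_of_add_eq_zero_left h, Q.polar_neg_left, hpf y _ hy p' hyw K.map_right, inv_one])
    have h₂ := hfx y _ hy p' hyv K.map_left (by
      rw [eq_neg_of_add_eq_zero_right h, Q.polar_neg_left, hpf x _ hx p hxv K.map_left, inv_one])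
    have h0 : ∀ x (hx : x + x = 0), flipHom θ hx (0, 0) = 0 := fun x hx => map_zero _
    rcases h₁ with rfl | rfl <;> rcases h₂ with rfl | rfl
    · rfl
    · rw [h0, zero_add, flipHom_one_one] at h
      exact absurd h K.right_ne
    · rw [h0, add_zero, flipHom_one_one] at h
      exact absurd h K.left_ne
    · rw [flipHom_one_one, flipHom_one_one] at h
      exact absurd h K.add_ne_zero
  · refine M.surjective_of_klein h2 K _ ⟨((1, 1), 0), ?_⟩ ⟨(0, (1, 1)), ?_⟩ fun z hz h => ?_
    · rw [AddMonoidHom.coprod_apply, map_zero, add_zero, flipHom_one_one]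
    · rw [AddMonoidHom.coprod_apply, map_zero, zero_add, flipHom_one_one]
    · have h₁ := h ((1, 0), 0)
      have h₂ := h (0, (1, 0))
      rw [AddMonoidHom.coprod_apply, map_zero, add_zero, flipHom_one_zero,
        IsQuadraticForm.polar_comm] at h₁
      rw [AddMonoidHom.coprod_apply, map_zero, zero_add, flipHom_one_zero,
        IsQuadraticForm.polar_comm] at h₂
      rcases K.mem z hz with h' | h' | h' | h' <;> rw [h'] at h₁ h₂
      · exact h'
      · exact absurd (hyv.symm.trans h₂) circle_neg_one_ne_one
      · exact absurd (hxw.symm.trans h₁) circle_neg_one_ne_one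
      · rw [Q.polar_add_right, hxv, hxw, one_mul] at h₁
        exact absurd h₁ circle_neg_one_ne_one
  · rintro ⟨⟨a, c⟩, b, d⟩
    have hxθx : polar q x (θ x) = q x ^ 2 := by
      have h4 : q x ^ 2 * q x ^ 2 = 1 := by
        rw [← Q.polar_self, ← Q.polar_add_right, hx, Q.polar_zero_right]
      have := hxv
      rw [Q.polar_add_right, Q.polar_self] at this
      exact mul_left_cancel (this.trans h4.symm)
    have hyθy : polar q y (θ y) = 1 := by
      have := hyw
      rwa [Q.polar_add_right, Q.polar_self, hqy, one_pow, one_mul] at this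
    have hxθy : polar q x (θ y) = -1 := by
      have := hxw
      rwa [Q.polar_add_right, hxy, one_mul] at this
    have hθxy : polar q (θ x) y = -1 := by rw [M.polar_map_left, hxθy]
    have hθxθy : polar q (θ x) (θ y) = 1 := by rw [M.polar_map_map, hxy]
    simp only [AddMonoidHom.coprod_apply, flipHom_apply]
    rw [IsQuadraticForm.map_add q, Q.map_zsmul_add_zsmul, Q.map_zsmul_add_zsmul, M.preserves,
      M.preserves]
    simp only [Q.polar_add_left, Q.polar_add_right, Q.polar_zsmul_left, Q.polar_zsmul_right, hqy,
      hxθx, hyθy, hxy, hxθy, hθxy, hθxθy, one_zpow, mul_one, one_mul]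
    simp only [crossForm, e, AddEquiv.coe_mk, Equiv.coe_fn_mk, zeta_two]
    rw [mul_comm]
    congr 1
    · norm_cast
      rw [← pow_mul, ← pow_mul, ← pow_add]
      congr 1
      ring
    · norm_cast
      rw [← pow_mul, ← pow_add, ← pow_add]
      congr 1
      ring
  · rintro ⟨⟨a, c⟩, b, d⟩
    rw [AddMonoidHom.coprod_apply, AddMonoidHom.coprod_apply, map_add, map_flipHom M,
      map_flipHom M]
    rfl

theorem circle_sq_eq_neg_one {z : Circle} (h : z ^ 2 = -1) : z = zeta 4 ∨ z = -zeta 4 := by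
  have h4 : zeta 4 ^ 2 = -1 := zeta_two_mul_pow 2 two_ne_zero
  have : (z * (zeta 4)⁻¹) ^ 2 = 1 := by rw [mul_pow, inv_pow, h, h4, mul_inv_cancel]
  rcases circle_sq_eq_one.1 this with h | h
  · exact Or.inl (mul_inv_eq_one.1 h)
  · right
    rw [mul_inv_eq_iff_eq_mul] at h
    rw [h, neg_mul, one_mul]

/-- Adding w keeps the trace and changes the sign of q(x), which is a fourth root of unity. -/
theorem exists_normalized_form (M : IsInvolutiveMetricGroup q θ) {x w : A} (hx : x + x = 0)
    (hθw : θ w = w) (hw : w + w = 0) (hqw : q w = 1) (hxw : polar q x w = -1) :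
    ∃ y, y + y = 0 ∧ y + θ y = x + θ x ∧ (q y = 1 ∨ q y = zeta 4) := by
  have h4 : (q x ^ 2) ^ 2 = 1 := by
    rw [sq (q x ^ 2), ← M.quad.polar_self, ← M.quad.polar_add_right, hx, M.quad.polar_zero_right]
  have hq' : q (x + w) = -q x := by
    rw [IsQuadraticForm.map_add q, hqw, hxw, mul_one, mul_neg, mul_one]
  have hxw' : x + w + (x + w) = 0 := by rw [add_add_add_comm, hx, hw, add_zero]
  have htr : x + w + θ (x + w) = x + θ x := trace_add_fixed hθw hw
  rcases circle_sq_eq_one.1 h4 with h | h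
  · rcases circle_sq_eq_one.1 h with h | h
    · exact ⟨x, hx, rfl, Or.inl h⟩
    · exact ⟨x + w, hxw', htr, Or.inl (by rw [hq', h, neg_neg])⟩
  · rcases circle_sq_eq_neg_one h with h | h
    · exact ⟨x, hx, rfl, Or.inr h⟩
    · exact ⟨x + w, hxw', htr, Or.inr (by rw [hq', h, neg_neg])⟩

theorem isIso_cross_of_form_eq_one (M : IsInvolutiveMetricGroup q θ)
    (h2 : ∃ k : ℕ, Nat.card A = 2 ^ k) (hq : ∀ g, θ g = g → q g = 1) {x y : A} (hx : x + x = 0)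
    (hy : y + y = 0) (K : IsKlein θ (x + θ x) (y + θ y)) (hqx : q x = 1 ∨ q x = zeta 4)
    (hqy : q y = 1) : IsIso q θ crossForm swapFour ∨ IsIso q θ crossForm' swapFour := by
  have Q := M.quad
  obtain ⟨hxv, hxw, hyv, hyw⟩ := polar_traces M hq hx hy K
  have key : IsIso q θ (fun p => crossForm p * q x ^ ((p.1.val + p.2.2.1.val) ^ 2)) swapFour := by
    rcases M.polar_eq_or hy x with h | h
    · exact isIso_cross M h2 hq hx hy K hqy h
    · have htr := trace_add_fixed (x := y) K.map_right K.add_self_right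
      -- The new y is θy: its pairing with x has the opposite sign, while q and the trace are
      -- unchanged.
      refine isIso_cross M h2 hq hx (y := y + (y + θ y)) ?_ ?_ ?_ ?_
      · rw [add_add_add_comm, hy, K.add_self_right, add_zero]
      · rwa [htr]
      · rw [IsQuadraticForm.map_add q, hqy, hyw, hq _ K.map_right, mul_one, mul_one]
      · rw [Q.polar_add_right, h, hxw, neg_mul_neg, mul_one]
  rcases hqx with h | h
  · left
    simpa [h] using key
  · right
    rw [h] at key
    exact key

theorem isIso_cross_or (M : IsInvolutiveMetricGroup q θ) (h2 : ∃ k : ℕ, Nat.card A = 2 ^ k)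
    (hq : ∀ g, θ g = g → q g = 1) {x y : A} (hx : x + x = 0)
    (hy : y + y = 0) (K : IsKlein θ (x + θ x) (y + θ y)) :
    IsIso q θ crossForm swapFour ∨ IsIso q θ crossForm' swapFour := by
  have Q := M.quad
  obtain ⟨-, hxw, hyv, -⟩ := polar_traces M hq hx hy K
  obtain ⟨x', hx', hxx', hqx⟩ := exists_normalized_form M hx K.map_right K.add_self_right
    (hq _ K.map_right) hxw
  obtain ⟨y', hy', hyy', hqy⟩ := exists_normalized_form M hy K.map_left K.add_self_left
    (hq _ K.map_left) hyv
  rw [← hxx', ← hyy'] at K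
  clear hxw hyv hxx' hyy' hx hy x y
  rcases hqy with hqy | hqy
  · exact isIso_cross_of_form_eq_one M h2 hq hx' hy' K hqx hqy
  rcases hqx with hqx | hqx
  · exact isIso_cross_of_form_eq_one M h2 hq hy' hx' K.symm (Or.inr hqy) hqx
  obtain ⟨hxv, hxw, hyv, hyw⟩ := polar_traces M hq hx' hy' K
  have hz : x' + y' + (x' + y') = 0 := by rw [add_add_add_comm, hx', hy', add_zero]
  have htr : x' + y' + θ (x' + y') = x' + θ x' + (y' + θ y') := by
    rw [map_add, add_add_add_comm]
  have h4 : zeta 4 * zeta 4 = -1 := by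
    rw [← sq]; exact zeta_two_mul_pow 2 two_ne_zero
  have hqz : q (x' + y') = -polar q x' y' := by
    rw [IsQuadraticForm.map_add q, hqx, hqy, h4, neg_mul, one_mul]
  -- Both values are i, so q(x' + y') = -⟨x', y'⟩. Either x' + y' or its sum with the trace of x'
  -- has q = 1 and can replace y'; the new trace is the sum of the two old ones.
  rcases M.polar_eq_or hy' x' with h | h
  · have htr' := trace_add_fixed (x := x' + y') K.map_left K.add_self_left
    refine isIso_cross_of_form_eq_one M h2 hq hx' (y := x' + y' + (x' + θ x')) ?_ ?_ (Or.inr hqx) ?_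
    · rw [add_add_add_comm, hz, K.add_self_left, add_zero]
    · rw [htr', htr]
      exact K.add_right
    · rw [IsQuadraticForm.map_add q, hqz, h, hq _ K.map_left, Q.polar_add_left, hxv, hyv]
      simp
  · refine isIso_cross_of_form_eq_one M h2 hq hx' hz ?_ (Or.inr hqx) ?_
    · rw [htr]
      exact K.add_right
    · rw [hqz, h, neg_neg]

end


section

variable {A : Type*} [AddCommGroup A] {q : A → Circle} {θ : A ≃+ A}

/-! ### Fixed two-torsion: diagonal forms -/

theorem IsKlein.exists_right {u v w : A} (K : IsKlein θ u v) (hw : θ w = w) (hw0 : w ≠ 0) :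
    ∃ g, IsKlein θ w g := by
  rcases K.mem w hw with rfl | rfl | rfl | rfl
  · exact absurd rfl hw0
  · exact ⟨v, K⟩
  · exact ⟨u, K.symm⟩
  · exact ⟨u, K.add_right.symm⟩

theorem polar_fixed_fixed (M : IsInvolutiveMetricGroup q θ) {u v : A} (K : IsKlein θ u v)
    (huu : polar q u u = 1) (hvv : polar q v v = 1) (huv : polar q u v = 1) {g h : A}
    (hg : θ g = g) (hh : θ h = h) : polar q g h = 1 := by
  have Q := M.quad
  have hvu : polar q v u = 1 := by rw [IsQuadraticForm.polar_comm, huv]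
  rcases K.mem g hg with rfl | rfl | rfl | rfl <;> rcases K.mem h hh with rfl | rfl | rfl | rfl <;>
    simp [Q.polar_zero_left, Q.polar_zero_right, Q.polar_add_left, Q.polar_add_right, huu, hvv,
      huv, hvu]

theorem form_two_pow_nsmul (Q : IsQuadraticForm q) {c : A} {k : ℕ}
    (h : q c ^ 2 ^ (k + 1) = -1) (hk : 1 ≤ k) :
    (k = 1 → q (2 ^ k • c) = -1) ∧ (2 ≤ k → q (2 ^ k • c) = 1) := by
  rw [Q.map_nsmul]
  constructor
  · rintro rfl
    exact h
  · intro h2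
    obtain ⟨l, rfl⟩ : ∃ l, k = l + 2 := ⟨k - 2, by omega⟩
    rw [show (2 ^ (l + 2)) ^ 2 = 2 ^ (l + 2 + 1) * (2 * 2 ^ l) by ring, pow_mul, h, pow_mul,
      neg_one_sq, one_pow]

/-- An orthogonal basis of a metric group whose two-torsion is the fixed Klein four-group. -/
structure IsDiagonalBasis (q : A → Circle) (θ : A ≃+ A) (c d : A) (k l : ℕ) : Prop where
  klein : IsKlein θ (2 ^ k • c) (2 ^ l • d)
  polar_eq_one : polar q c d = 1
  polar_left : polar q c (2 ^ k • c) = -1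
  polar_right : polar q d (2 ^ l • d) = -1

/-- The fixed points orthogonal to c are 0 and some e. An element pairing to -1 with e can be made
orthogonal to c; its last nonzero multiple by a power of two is an involution, hence fixed, and
orthogonal to c, so it is e. -/
theorem exists_isDiagonalBasis (M : IsInvolutiveMetricGroup q θ)
    (h2 : ∃ k : ℕ, Nat.card A = 2 ^ k) {u v : A} (K : IsKlein θ u v)
    (htor : ∀ y, y + y = 0 → θ y = y) {c : A} {k : ℕ} (hck' : 2 ^ (k + 1) • c = 0)
    (hc : polar q c (2 ^ k • c) = -1) : ∃ d l, IsDiagonalBasis q θ c d k l := by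
  have Q := M.quad
  have hw : θ (2 ^ k • c) = 2 ^ k • c := htor _ (by rw [← two_nsmul, ← mul_nsmul, ← pow_succ, hck'])
  have hw0 : 2 ^ k • c ≠ 0 := by
    intro h
    rw [h, Q.polar_zero_right] at hc
    exact circle_neg_one_ne_one hc.symm
  obtain ⟨g, K'⟩ := K.exists_right hw hw0
  obtain ⟨e, K', hce⟩ : ∃ e, IsKlein θ (2 ^ k • c) e ∧ polar q c e = 1 := by
    rcases M.polar_eq_or K'.add_self_right c with h | h
    · exact ⟨g, K', h⟩
    · exact ⟨_, K'.add_right, by rw [Q.polar_add_right, hc, h, neg_mul_neg, one_mul]⟩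
  have hV : ∀ y, θ y = y → polar q c y = 1 → y = 0 ∨ y = e := by
    intro y hy hcy
    rcases K'.mem y hy with rfl | rfl | rfl | rfl
    · exact Or.inl rfl
    · exact absurd (hc.symm.trans hcy) circle_neg_one_ne_one
    · exact Or.inr rfl
    · rw [Q.polar_add_right, hc, hce, mul_one] at hcy
      exact absurd hcy circle_neg_one_ne_one
  obtain ⟨d', hd'⟩ := M.exists_polar_eq_neg_one K'.right_ne K'.add_self_right
  -- Thus every value ⟨c, d'⟩ is a power of ⟨c, c⟩, so subtracting a multiple of c makes d'
  -- orthogonal to c.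
  have hprim : IsPrimitiveRoot (polar q c c : ℂ) (2 ^ (k + 1)) := by
    have h₁ : polar q c c ^ 2 ^ k = -1 := by rw [← Q.polar_nsmul_right, hc]
    have h₂ : polar q c c ^ 2 ^ (k + 1) = 1 := by
      rw [← Q.polar_nsmul_right, hck', Q.polar_zero_right]
    rw [← orderOf_eq_prime_pow (x := polar q c c) (p := 2) (n := k)
      (by rw [h₁]; exact circle_neg_one_ne_one) h₂]
    exact (IsPrimitiveRoot.orderOf (polar q c c)).map_of_injective (f := Circle.coeHom)
      Circle.coe_injective
  obtain ⟨j, -, hj⟩ := hprim.eq_pow_of_pow_eq_one (ξ := (polar q c d' : ℂ)) (by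
    rw [← Circle.coe_pow, ← Q.polar_nsmul_left, hck', Q.polar_zero_left]; rfl)
  have hj : polar q c c ^ j = polar q c d' := Circle.ext (by simpa using hj)
  obtain ⟨d, hcd, hde⟩ : ∃ d, polar q c d = 1 ∧ polar q d e = -1 := by
    refine ⟨d' - j • c, ?_, ?_⟩
    · rw [Q.polar_sub_right, Q.polar_nsmul_right, hj, mul_inv_cancel]
    · rw [Q.polar_sub_left, Q.polar_nsmul_left, hce, hd', one_pow, inv_one, mul_one]
  have hd0 : d ≠ 0 := by
    rintro rfl
    rw [Q.polar_zero_left] at hde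
    exact circle_neg_one_ne_one hde.symm
  obtain ⟨l, hl, hl'⟩ := exists_pow_smul_ne_zero h2 hd0
  have hle : 2 ^ l • d = e := by
    refine (hV _ (htor _ ?_) ?_).resolve_left hl
    · rw [← two_nsmul, ← mul_nsmul, ← pow_succ, hl']
    · rw [Q.polar_nsmul_right, hcd, one_pow]
  exact ⟨d, l, by rwa [hle], hcd, hc, by rwa [hle]⟩

/-! ### Involutions in an orthogonal basis -/

namespace IsDiagonalBasis

variable {c d : A} {k l : ℕ}

theorem symm (D : IsDiagonalBasis q θ c d k l) : IsDiagonalBasis q θ d c l k where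
  klein := D.klein.symm
  polar_eq_one := by rw [IsQuadraticForm.polar_comm, D.polar_eq_one]
  polar_left := D.polar_right
  polar_right := D.polar_left

theorem two_pow_nsmul (D : IsDiagonalBasis q θ c d k l) : 2 ^ (k + 1) • c = 0 := by
  rw [pow_succ, mul_nsmul, two_nsmul, D.klein.add_self_left]

theorem form_left (D : IsDiagonalBasis q θ c d k l) (Q : IsQuadraticForm q) :
    q c ^ 2 ^ (k + 1) = -1 := by
  rw [pow_succ', pow_mul, ← Q.polar_self, ← Q.polar_nsmul_right, D.polar_left]

theorem polar_cross (D : IsDiagonalBasis q θ c d k l) (Q : IsQuadraticForm q) :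
    polar q c (2 ^ l • d) = 1 := by
  rw [Q.polar_nsmul_right, D.polar_eq_one, one_pow]

/-- The model involution is left open and compared with θ on integer combinations, so one
isomorphism serves all the involutions. The moduli are variables with equations so that `ZMod 4` can
be used literally. -/
theorem exists_isIso (D : IsDiagonalBasis q θ c d k l) (M : IsInvolutiveMetricGroup q θ)
    (h2 : ∃ k : ℕ, Nat.card A = 2 ^ k) {N N' : ℕ} (hN : N = 2 ^ (k + 1)) (hN' : N' = 2 ^ (l + 1)) :
    ∃ r s : ℤ, Odd r ∧ Odd s ∧ ∀ θ' : ZMod N × ZMod N' → ZMod N × ZMod N',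
      (∀ i j : ℤ, ∃ i' j' : ℤ, θ (i • c + j • d) = i' • c + j' • d ∧
        ∀ x y, ((x : ZMod N).val : ℤ) = i → ((y : ZMod N').val : ℤ) = j →
          θ' (x, y) = ((i' : ZMod N), (j' : ZMod N'))) →
      IsIso q θ (prodForm (cyclicForm N r) (cyclicForm N' s)) θ' := by
  subst hN hN'
  have Q := M.quad
  obtain ⟨r, hr, hrc⟩ := exists_odd_zeta_zpow (by positivity) (D.form_left Q)
  obtain ⟨s, hs, hsd⟩ := exists_odd_zeta_zpow (by positivity) (D.symm.form_left Q)
  refine ⟨r, s, hr, hs, fun θ' hθ' => ?_⟩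
  have hc := D.two_pow_nsmul
  have hd := D.symm.two_pow_nsmul
  refine isIso_of_hom ((cyc hc).coprod (cyc hd)) ?_ ?_ ?_ ?_
  · exact injective_coprod_of_involutions ⟨_, card_zmod_two_pow _⟩ ⟨_, card_zmod_two_pow _⟩ _ _
      (cyc_involution hc) (cyc_involution hd) D.klein.left_ne D.klein.right_ne D.klein.add_ne_zero
  · refine M.surjective_of_klein h2 D.klein _ ⟨(((2 ^ k : ℕ) : ℤ), 0), ?_⟩
      ⟨(0, ((2 ^ l : ℕ) : ℤ)), ?_⟩ fun y hy h => ?_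
    · rw [AddMonoidHom.coprod_apply, map_zero, add_zero, cyc_intCast, natCast_zsmul]
    · rw [AddMonoidHom.coprod_apply, map_zero, zero_add, cyc_intCast, natCast_zsmul]
    · have h₁ := h (1, 0)
      have h₂ := h (0, 1)
      rw [AddMonoidHom.coprod_apply, map_zero, add_zero, cyc_one,
        IsQuadraticForm.polar_comm] at h₁
      rw [AddMonoidHom.coprod_apply, map_zero, zero_add, cyc_one,
        IsQuadraticForm.polar_comm] at h₂
      rcases D.klein.mem y hy with h' | h' | h' | h' <;> rw [h'] at h₁ h₂
      · exact h'
      · exact absurd (D.polar_left.symm.trans h₁) circle_neg_one_ne_one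
      · exact absurd (D.polar_right.symm.trans h₂) circle_neg_one_ne_one
      · rw [Q.polar_add_right, D.polar_left, D.polar_cross Q, mul_one] at h₁
        exact absurd h₁ circle_neg_one_ne_one
  · intro p
    rw [form_coprod _ _ (polar_cyc_cyc Q hc hd D.polar_eq_one), form_cyc Q hc hrc,
      form_cyc Q hd hsd, prodForm]
  · rintro ⟨x, y⟩
    obtain ⟨i', j', h, h'⟩ := hθ' x.val y.val
    rw [h' x y rfl rfl, AddMonoidHom.coprod_apply, AddMonoidHom.coprod_apply, cyc_apply, cyc_apply,
      cyc_intCast, cyc_intCast, h]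

/-- θ is determined by the traces of c and d, each among 0, w = 2^k c, u = 2^l d, w + u.
Self-adjointness, the trace identity and the fact that fixed points are killed by two leave only the
traces (0, 0) and one twisted pair. The value q(w) is -1 if k = 1 and 1 if k ≥ 2, which separates
the two conclusions. -/
theorem classify (D : IsDiagonalBasis q θ c d k l) (M : IsInvolutiveMetricGroup q θ)
    (h2 : ∃ k : ℕ, Nat.card A = 2 ^ k) (hiso : ∀ g h, θ g = g → θ h = h → polar q g h = 1)
    (hkl : k ≤ l) :
    ((∃ g, θ g = g ∧ q g = -1) ∧
      ∃ (n : ℕ) (r₁ r₂ : ℤ) (θ' : ZMod 4 × ZMod (2 ^ n) → ZMod 4 × ZMod (2 ^ n)),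
        2 ≤ n ∧ Odd r₁ ∧ Odd r₂ ∧ ((θ' = fun p => -p) ∨ (3 ≤ n ∧ θ' = twistFour n)) ∧
        IsIso q θ (prodForm (cyclicForm 4 r₁) (cyclicForm (2 ^ n) r₂)) θ') ∨
    ((∀ g, θ g = g → q g = 1) ∧
      ∃ (m n : ℕ) (r₁ r₂ : ℤ)
        (θ' : ZMod (2 ^ m) × ZMod (2 ^ n) → ZMod (2 ^ m) × ZMod (2 ^ n)),
        3 ≤ m ∧ m ≤ n ∧ Odd r₁ ∧ Odd r₂ ∧ ((θ' = fun p => -p) ∨ θ' = twistDiag m n) ∧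
        IsIso q θ (prodForm (cyclicForm (2 ^ m) r₁) (cyclicForm (2 ^ n) r₂)) θ') := by
  have Q := M.quad
  have K := D.klein
  have hk : 1 ≤ k := by
    rw [Nat.one_le_iff_ne_zero]
    rintro rfl
    have h₁ := D.polar_left
    have h₂ := K.map_left
    rw [pow_zero, one_nsmul] at h₁ h₂
    rw [hiso c c h₂ h₂] at h₁
    exact circle_neg_one_ne_one h₁.symm
  obtain ⟨hw₁, hw₂⟩ := form_two_pow_nsmul Q (D.form_left Q) hk
  obtain ⟨hu₁, hu₂⟩ := form_two_pow_nsmul Q (D.symm.form_left Q) (hk.trans hkl)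
  have hcw := D.polar_left
  have hdu := D.polar_right
  have hcu := D.polar_cross Q
  have hdw := D.symm.polar_cross Q
  have hwu := hiso _ _ K.map_left K.map_right
  obtain ⟨w, hw⟩ : ∃ w, 2 ^ k • c = w := ⟨_, rfl⟩
  obtain ⟨u, hu⟩ : ∃ u, 2 ^ l • d = u := ⟨_, rfl⟩
  rw [hw] at K hw₁ hw₂ hcw hdw hwu
  rw [hu] at K hu₁ hu₂ hcu hdu hwu
  have hwc : polar q w c = -1 := by rw [IsQuadraticForm.polar_comm, hcw]
  have huc : polar q u c = 1 := by rw [IsQuadraticForm.polar_comm, hcu]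
  have hwd : polar q w d = 1 := by rw [IsQuadraticForm.polar_comm, hdw]
  have hud : polar q u d = -1 := by rw [IsQuadraticForm.polar_comm, hdu]
  have hwZ : ((2 : ℤ) ^ k) • c = w := by rw [← hw]; exact_mod_cast natCast_zsmul c (2 ^ k)
  have huZ : ((2 : ℤ) ^ l) • d = u := by rw [← hu]; exact_mod_cast natCast_zsmul d (2 ^ l)
  have hquw : q (w + u) = q w * q u := by rw [IsQuadraticForm.map_add q, hwu, mul_one]
  have E₁ := M.form_add_map c
  have E₂ := M.form_add_map d
  have E₃ : polar q c (d + θ d) = polar q (c + θ c) d := by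
    rw [Q.polar_add_right, Q.polar_add_left, M.polar_map_left]
  -- Such an x is not killed by two.
  have hc4 : ∀ x, 2 • x = w ∨ 2 • x = u ∨ 2 • x = w + u → θ x ≠ x := by
    intro x hx h
    have := K.add_self h
    rw [← two_nsmul] at this
    rw [this] at hx
    rcases hx with h | h | h
    · exact K.left_ne h.symm
    · exact K.right_ne h.symm
    · exact K.add_ne_zero h.symm
  have hneg : ∀ {c d : A}, c + θ c = 0 → θ c = -c := fun h => eq_neg_of_add_eq_zero_right h
  have hc_lt : k = 1 → c + θ c ≠ w := by
    rintro rfl h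
    rw [← hw, pow_one, two_nsmul] at h
    refine hc4 c (Or.inl ?_) (add_left_cancel h)
    rw [← hw, pow_one]
  have hd_lt : l = 1 → d + θ d ≠ u := by
    rintro rfl h
    rw [← hu, pow_one, two_nsmul] at h
    refine hc4 d (Or.inr (Or.inl ?_)) (add_left_cancel h)
    rw [← hu, pow_one]
  have hone := circle_neg_one_ne_one
  have c₁ : c + θ c = w → q w = -1 := fun h => by rw [h, hwc] at E₁; exact E₁
  have c₂ : c + θ c = u → q u = 1 := fun h => by rw [h, huc] at E₁; exact E₁
  have c₃ : c + θ c = w + u → q w * q u = -1 := fun h => by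
    rw [h, Q.polar_add_left, hwc, huc, mul_one, hquw] at E₁; exact E₁
  have d₁ : d + θ d = u → q u = -1 := fun h => by rw [h, hud] at E₂; exact E₂
  have d₂ : d + θ d = w → q w = 1 := fun h => by rw [h, hwd] at E₂; exact E₂
  have d₃ : d + θ d = w + u → q w * q u = -1 := fun h => by
    rw [h, Q.polar_add_left, hwd, hud, one_mul, hquw] at E₂; exact E₂
  clear E₁ E₂
  -- By `E₃`, the trace of c involves u exactly when the trace of d involves w.
  have hcd : ((c + θ c = 0 ∨ c + θ c = w) ∧ (d + θ d = 0 ∨ d + θ d = u)) ∨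
      ((c + θ c = u ∨ c + θ c = w + u) ∧ (d + θ d = w ∨ d + θ d = w + u)) := by
    have hC : (c + θ c = 0 ∨ c + θ c = w) ∨ (c + θ c = u ∨ c + θ c = w + u) :=
      or_assoc.2 (K.mem _ (M.map_add_map c))
    have hD : (d + θ d = 0 ∨ d + θ d = u) ∨ (d + θ d = w ∨ d + θ d = w + u) := by
      rw [add_comm w u]
      exact or_assoc.2 (K.symm.mem _ (M.map_add_map d))
    have c₁ : c + θ c = 0 ∨ c + θ c = w → polar q (c + θ c) d = 1 := by
      rintro (h | h) <;> rw [h]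
      exacts [Q.polar_zero_left d, hwd]
    have c₂ : c + θ c = u ∨ c + θ c = w + u → polar q (c + θ c) d = -1 := by
      rintro (h | h) <;> rw [h]
      exacts [hud, by rw [Q.polar_add_left, hwd, hud, one_mul]]
    have d₁ : d + θ d = 0 ∨ d + θ d = u → polar q c (d + θ d) = 1 := by
      rintro (h | h) <;> rw [h]
      exacts [Q.polar_zero_right c, hcu]
    have d₂ : d + θ d = w ∨ d + θ d = w + u → polar q c (d + θ d) = -1 := by
      rintro (h | h) <;> rw [h]
      exacts [hcw, by rw [Q.polar_add_right, hcw, hcu, mul_one]]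
    have hno : ∀ z : Circle, z = 1 → z = -1 → False := fun z h h' => hone (h'.symm.trans h)
    rcases hC with h | h <;> rcases hD with h' | h'
    · exact Or.inl ⟨h, h'⟩
    · exact (hno _ (c₁ h) (E₃.symm.trans (d₂ h'))).elim
    · exact (hno _ (d₁ h') (E₃.trans (c₂ h))).elim
    · exact Or.inr ⟨h, h'⟩
  rcases hk.eq_or_lt with rfl | hk2
  · -- the first summand has order four
    left
    have hqw := hw₁ rfl
    refine ⟨⟨w, K.map_left, hqw⟩, ?_⟩
    obtain ⟨r, s, hr, hs, hiso'⟩ := D.exists_isIso M h2 (N := 4)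
      (N' := 2 ^ (l + 1)) (by norm_num) rfl
    have hcase : (c + θ c = 0 ∧ d + θ d = 0) ∨ (2 ≤ l ∧ c + θ c = u ∧ d + θ d = w + u) := by
      rcases hkl.eq_or_lt with rfl | hl2
      · have hqu := hu₁ rfl
        rcases hcd with ⟨h | h, h' | h'⟩ | ⟨h | h, -⟩
        · exact Or.inl ⟨h, h'⟩
        · exact absurd h' (hd_lt rfl)
        · exact absurd h (hc_lt rfl)
        · exact absurd h (hc_lt rfl)
        · exact absurd (hqu.symm.trans (c₂ h)) hone
        · have := c₃ h
          rw [hqw, hqu, neg_mul_neg, one_mul] at this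
          exact absurd this.symm hone
      · have hqu := hu₂ hl2
        -- If this were the trace, c + 2^(l-1) d would be fixed although its double is w + u.
        have hbad : c + θ c ≠ w + u := by
          intro h
          obtain ⟨m, rfl⟩ : ∃ m, l = m + 2 := ⟨l - 2, by omega⟩
          have hz : θ (2 ^ (m + 1) • d) = -(2 ^ (m + 1) • d) := by
            have h₁ : θ d = (d + θ d) - d := by abel
            have h₂ := K.add_self (M.map_add_map d)
            rw [map_nsmul, h₁, nsmul_sub, pow_succ', mul_nsmul, two_nsmul, h₂, smul_zero, zero_sub]
          have hc' : θ c = c + u := by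
            have : c + θ c = c + (c + u) := by
              rw [h, ← hw, pow_one, two_nsmul, add_assoc]
            exact add_left_cancel this
          have hu' : u = 2 ^ (m + 1) • d + 2 ^ (m + 1) • d := by
            rw [← hu, ← two_nsmul, ← mul_nsmul, ← pow_succ]
          refine hc4 (c + 2 ^ (m + 1) • d) (Or.inr (Or.inr ?_)) ?_
          · rw [nsmul_add, ← hw, pow_one, two_nsmul (2 ^ (m + 1) • d), hu']
          · rw [map_add, hz, hc', hu']
            abel
        rcases hcd with ⟨h | h, h' | h'⟩ | ⟨h | h, h' | h'⟩
        · exact Or.inl ⟨h, h'⟩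
        · exact absurd ((d₁ h').symm.trans hqu) hone
        · exact absurd h (hc_lt rfl)
        · exact absurd h (hc_lt rfl)
        · exact absurd (hqw.symm.trans (d₂ h')) hone
        · exact Or.inr ⟨hl2, h, h'⟩
        · exact absurd h hbad
        · exact absurd h hbad
    rcases hcase with ⟨h, h'⟩ | ⟨hl2, h, h'⟩
    · refine ⟨l + 1, r, s, fun p => -p, by omega, hr, hs, Or.inl rfl, hiso' _ fun i j =>
        ⟨-i, -j, ?_, ?_⟩⟩
      · rw [map_add, map_zsmul, map_zsmul, eq_neg_of_add_eq_zero_right h,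
          eq_neg_of_add_eq_zero_right h']
        simp
      · rintro x y rfl rfl
        simp
    · refine ⟨l + 1, r, s, twistFour (l + 1), by omega, hr, hs, Or.inr ⟨by omega, rfl⟩,
        hiso' _ fun i j => ⟨-i + 2 * j, 2 ^ l * i + (-1 + 2 ^ l) * j, ?_, ?_⟩⟩
      · have h₁ : θ c = u - c := by rw [← h]; abel
        have h₂ : θ d = w + u - d := by rw [← h']; abel
        rw [map_add, map_zsmul, map_zsmul, h₁, h₂, ← hwZ, ← huZ]
        module
      · rintro x y rfl rfl
        simp [twistFour]
  · right
    have hqw := hw₂ hk2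
    have hqu := hu₂ (le_trans hk2 hkl)
    have hall : ∀ g, θ g = g → q g = 1 := by
      intro g hg
      rcases K.mem g hg with rfl | rfl | rfl | rfl
      · exact Q.map_zero
      · exact hqw
      · exact hqu
      · rw [hquw, hqw, hqu, one_mul]
    refine ⟨hall, ?_⟩
    obtain ⟨r, s, hr, hs, hiso'⟩ := D.exists_isIso M h2 rfl rfl
    have hcase : (c + θ c = 0 ∧ d + θ d = 0) ∨ (c + θ c = u ∧ d + θ d = w) := by
      have hno : q w * q u ≠ -1 := by
        rw [hqw, hqu, one_mul]
        exact hone.symm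
      rcases hcd with ⟨h | h, h' | h'⟩ | ⟨h | h, h' | h'⟩
      · exact Or.inl ⟨h, h'⟩
      · exact absurd ((d₁ h').symm.trans hqu) hone
      · exact absurd ((c₁ h).symm.trans hqw) hone
      · exact absurd ((c₁ h).symm.trans hqw) hone
      · exact Or.inr ⟨h, h'⟩
      · exact absurd (d₃ h') hno
      · exact absurd (c₃ h) hno
      · exact absurd (c₃ h) hno
    rcases hcase with ⟨h, h'⟩ | ⟨h, h'⟩
    · refine ⟨k + 1, l + 1, r, s, fun p => -p, by omega, by omega, hr, hs, Or.inl rfl,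
        hiso' _ fun i j => ⟨-i, -j, ?_, ?_⟩⟩
      · rw [map_add, map_zsmul, map_zsmul, eq_neg_of_add_eq_zero_right h,
          eq_neg_of_add_eq_zero_right h']
        simp
      · rintro x y rfl rfl
        simp
    · refine ⟨k + 1, l + 1, r, s, twistDiag (k + 1) (l + 1), by omega, by omega, hr, hs,
        Or.inr rfl, hiso' _ fun i j => ⟨-i + 2 ^ k * j, 2 ^ l * i - j, ?_, ?_⟩⟩
      · have h₁ : θ c = u - c := by rw [← h]; abel
        have h₂ : θ d = w - d := by rw [← h']; abel
        rw [map_add, map_zsmul, map_zsmul, h₁, h₂, ← hwZ, ← huZ]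
        module
      · rintro x y rfl rfl
        simp [twistDiag]

end IsDiagonalBasis

end


/-! ### Solving quadratic congruences modulo powers of two -/

/-- Hensel lifting: at an even y the derivative 2γy + 1 is odd, so subtracting the current value of
the polynomial gains a factor of two. -/
theorem exists_even_root (γ c : ℤ) (hc : Even c) (n : ℕ) :
    ∃ y : ℤ, Even y ∧ (2 ^ (n + 1) : ℤ) ∣ γ * y ^ 2 + y + c := by
  induction n with
  | zero => exact ⟨0, Even.zero, by simpa using hc.two_dvd⟩
  | succ n ih =>
    obtain ⟨y, hy, m, hm⟩ := ih
    obtain ⟨z, rfl⟩ := hy.two_dvd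
    refine ⟨2 * z - 2 ^ (n + 1) * m, ?_, ?_⟩
    · rw [pow_succ]
      exact ⟨z - 2 ^ n * m, by ring⟩
    · refine ⟨-(2 * γ * z * m) + γ * m ^ 2 * 2 ^ n, ?_⟩
      have h₁ : γ * (2 * z - 2 ^ (n + 1) * m) ^ 2 + (2 * z - 2 ^ (n + 1) * m) + c =
          (γ * (2 * z) ^ 2 + 2 * z + c) - 2 ^ (n + 1) * m - 2 ^ (n + 1) * (4 * γ * z * m)
            + γ * (2 ^ (n + 1) * m) ^ 2 := by ring
      rw [h₁, hm]
      ring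

theorem exists_inverse_mod {a : ℤ} (ha : Odd a) (n : ℕ) :
    ∃ t : ℤ, Odd t ∧ (2 ^ (n + 1) : ℤ) ∣ t * a - 1 := by
  have hcop : IsCoprime a (2 ^ (n + 1)) :=
    (Int.isCoprime_iff_gcd_eq_one.2 (by
      rw [Int.gcd_comm]
      exact Int.isCoprime_iff_gcd_eq_one.1 (Int.isCoprime_two_left.2 ha))).pow_right
  obtain ⟨t, s, h⟩ := hcop
  have hdvd : (2 ^ (n + 1) : ℤ) ∣ t * a - 1 := ⟨-s, by linarith⟩
  refine ⟨t, ?_, hdvd⟩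
  by_contra hodd
  rw [Int.not_odd_iff_even] at hodd
  have h1 : (2 : ℤ) ∣ t * a - 1 := (dvd_pow_self 2 n.succ_ne_zero).trans hdvd
  have h2 : (2 : ℤ) ∣ t * a := hodd.two_dvd.mul_right a
  have := (Int.dvd_iff_dvd_of_dvd_sub h1).1 h2
  norm_num at this

theorem zeta_zpow_eq {n : ℕ} {a b : ℤ} (h : (2 ^ (n + 1) : ℤ) ∣ a - b) :
    zeta (2 ^ (n + 1)) ^ a = zeta (2 ^ (n + 1)) ^ b := by
  obtain ⟨m, hm⟩ := h
  have h1 : zeta (2 ^ (n + 1)) ^ (2 ^ (n + 1) : ℤ) = 1 := by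
    exact_mod_cast zeta_pow_self (2 ^ (n + 1)) (by positivity)
  rw [show a = b + 2 ^ (n + 1) * m by linarith, zpow_add, zpow_mul, h1, one_zpow, mul_one]

section

variable {A : Type*} [AddCommGroup A] {q : A → Circle} {θ : A ≃+ A}

/-! ### Fixed two-torsion: even forms -/

/-- The form takes the values `ζ^α`, `ζ^γ` at `a`, `b`, and `⟨a, b⟩_q = ζ^β`, for `ζ = ζ_{2ⁿ⁺¹}`. -/
structure HasGram (q : A → Circle) (n : ℕ) (a b : A) (α β γ : ℤ) : Prop where
  left : q a = zeta (2 ^ (n + 1)) ^ α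
  mid : polar q a b = zeta (2 ^ (n + 1)) ^ β
  right : q b = zeta (2 ^ (n + 1)) ^ γ

namespace HasGram

variable {n : ℕ} {a b : A} {α β γ : ℤ}

theorem symm (h : HasGram q n a b α β γ) : HasGram q n b a γ β α :=
  ⟨h.right, by rw [IsQuadraticForm.polar_comm, h.mid], h.left⟩

theorem congr (h : HasGram q n a b α β γ) {α' β' γ' : ℤ} (hα : (2 ^ (n + 1) : ℤ) ∣ α - α')
    (hβ : (2 ^ (n + 1) : ℤ) ∣ β - β') (hγ : (2 ^ (n + 1) : ℤ) ∣ γ - γ') :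
    HasGram q n a b α' β' γ' :=
  ⟨h.left.trans (zeta_zpow_eq hα), h.mid.trans (zeta_zpow_eq hβ), h.right.trans (zeta_zpow_eq hγ)⟩

theorem combine (h : HasGram q n a b α β γ) (Q : IsQuadraticForm q) (i j : ℤ) :
    HasGram q n a (i • a + j • b) α (2 * α * i + β * j) (α * i ^ 2 + β * (i * j) + γ * j ^ 2) where
  left := h.left
  mid := by
    rw [Q.polar_add_right, Q.polar_zsmul_right, Q.polar_zsmul_right, Q.polar_self, h.left, h.mid,
      ← zpow_natCast, ← zpow_mul, ← zpow_mul, ← zpow_mul, ← zpow_add]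
    congr 1
    push_cast
    ring
  right := by
    rw [Q.map_zsmul_add_zsmul, h.left, h.mid, h.right, ← zpow_mul, ← zpow_mul, ← zpow_mul,
      ← zpow_add, ← zpow_add]
    congr 1
    ring

theorem scale (h : HasGram q n a b α β γ) (Q : IsQuadraticForm q) (j : ℤ) :
    HasGram q n a (j • b) α (β * j) (γ * j ^ 2) := by
  simpa using h.combine Q 0 j

/-- An even unimodular binary form is hyperbolic or elliptic. -/
theorem exists_normal_form (h : HasGram q n a b α β γ) (Q : IsQuadraticForm q) (hβ : Odd β) :
    ∃ a' b', HasGram q n a' b' 0 1 0 ∨ HasGram q n a' b' 1 1 1 := by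
  obtain ⟨t, ht, htd⟩ := exists_inverse_mod hβ n
  replace h : HasGram q n a (t • b) α 1 (γ * t ^ 2) :=
    (h.scale Q t).congr (by simp) (by rwa [mul_comm]) (by simp)
  generalize t • b = b at h
  generalize γ * t ^ 2 = γ at h
  -- once the first value is normalized, rescale the second vector
  have rescale : ∀ {a b : A} {α β γ : ℤ}, HasGram q n a b α β γ → Odd β →
      ∃ b' t, HasGram q n a b' α 1 (γ * t ^ 2) ∧ Odd t := by
    intro a b α β γ h hβ
    obtain ⟨t, ht, htd⟩ := exists_inverse_mod hβ n
    exact ⟨t • b, t, (h.scale Q t).congr (by simp) (by rwa [mul_comm]) (by simp), ht⟩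
  -- A root y makes a + yb isotropic. Since y enters the pairing through 1 + 2γy, that pairing stays
  -- invertible; after rescaling, a multiple of the isotropic vector clears the other value.
  have isotropic : ∀ {a b : A} {α γ : ℤ}, HasGram q n a b α 1 γ → Even α →
      ∃ a' b', HasGram q n a' b' 0 1 0 := by
    intro a b α γ h hα
    obtain ⟨y, hy, hyd⟩ := exists_even_root γ α hα n
    have h₁ : HasGram q n b ((1 : ℤ) • a + y • b) γ (1 + 2 * γ * y) 0 := by
      rw [add_comm]
      exact (h.symm.combine Q y 1).congr (by simp) (by simp [add_comm]) (by
        convert hyd using 1; ring)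
    obtain ⟨b', t, h₂, -⟩ := rescale h₁.symm ((even_two_mul _).mul_right y |>.one_add)
    refine ⟨_, _, (h₂.combine Q (-(γ * t ^ 2)) 1).congr (by simp) (by simp) (by simp)⟩
  rcases Int.even_or_odd α with hα | hα
  · obtain ⟨a', b', h'⟩ := isotropic h hα
    exact ⟨a', b', Or.inl h'⟩
  rcases Int.even_or_odd γ with hγ | hγ
  · obtain ⟨a', b', h'⟩ := isotropic h.symm hγ
    exact ⟨a', b', Or.inl h'⟩
  obtain ⟨y, hy, hyd⟩ := exists_even_root γ (α - 1) (hα.sub_odd odd_one) n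
  have h₁ : HasGram q n b ((1 : ℤ) • a + y • b) γ (1 + 2 * γ * y) 1 := by
    rw [add_comm]
    exact (h.symm.combine Q y 1).congr (by simp) (by simp [add_comm]) (by
      convert hyd using 1; ring)
  obtain ⟨b', t, h₂, ht⟩ := rescale h₁.symm ((even_two_mul _).mul_right y |>.one_add)
  have hγ' : Odd (γ * t ^ 2) := hγ.mul ht.pow
  generalize γ * t ^ 2 = δ at h₂ hγ'
  -- The second vector becomes s a' + (1 - 2s) b', whose pairing with a' is still 1. Its value is δ
  -- + (1 - 4δ)(s - s²); setting this to 1 and dividing by 1 - 4δ gives the quadratic solved for s.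
  obtain ⟨u, -, hu⟩ := exists_inverse_mod (a := 1 - 4 * δ) (by
    rw [sub_eq_add_neg]; exact (Even.neg ⟨2 * δ, by ring⟩).one_add) n
  obtain ⟨s, -, hs⟩ := exists_even_root (-1) (u * (δ - 1)) ((hγ'.sub_odd odd_one).mul_left u) n
  refine ⟨_, _, Or.inr ((h₂.combine Q s (1 - 2 * s)).congr (by simp) (by
    ring_nf; simp) ?_)⟩
  have e : 1 * s ^ 2 + 1 * (s * (1 - 2 * s)) + δ * (1 - 2 * s) ^ 2 - 1 =
      (1 - 4 * δ) * (-1 * s ^ 2 + s + u * (δ - 1)) - (δ - 1) * (u * (1 - 4 * δ) - 1) := by ring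
  rw [e]
  exact dvd_sub (hs.mul_left _) (hu.mul_left _)

end HasGram

/-- As q = 1 on fixed points, every z is orthogonal to its trace. Applied to a and b this leaves two
traces each; applied to a + b it rules out mixed choices. -/
theorem map_eq_or_of_even (M : IsInvolutiveMetricGroup q θ) {n : ℕ} {a b : A}
    (K : IsKlein θ (2 ^ n • a) (2 ^ n • b)) (hq : ∀ g, θ g = g → q g = 1)
    (haa : polar q (2 ^ n • a) a = 1) (hab : polar q (2 ^ n • a) b = -1)
    (hba : polar q (2 ^ n • b) a = -1) (hbb : polar q (2 ^ n • b) b = 1) :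
    (θ a = -a ∧ θ b = -b) ∨ (θ a = -a + 2 ^ n • a ∧ θ b = -b + 2 ^ n • b) := by
  have Q := M.quad
  have hone := circle_neg_one_ne_one
  have key : ∀ z, polar q (z + θ z) z = 1 := fun z => by
    rw [← M.form_add_map, hq _ (M.map_add_map z)]
  have ha : a + θ a = 0 ∨ a + θ a = 2 ^ n • a := by
    have h := key a
    rcases K.mem _ (M.map_add_map a) with h' | h' | h' | h' <;> rw [h'] at h
    · exact Or.inl h'
    · exact Or.inr h'
    · exact absurd (hba.symm.trans h) hone
    · rw [Q.polar_add_left, haa, hba, one_mul] at h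
      exact absurd h hone
  have hb : b + θ b = 0 ∨ b + θ b = 2 ^ n • b := by
    have h := key b
    rcases K.mem _ (M.map_add_map b) with h' | h' | h' | h' <;> rw [h'] at h
    · exact Or.inl h'
    · exact absurd (hab.symm.trans h) hone
    · exact Or.inr h'
    · rw [Q.polar_add_left, hab, hbb, mul_one] at h
      exact absurd h hone
  have hsum := key (a + b)
  rw [map_add, add_add_add_comm, Q.polar_add_left, Q.polar_add_right, Q.polar_add_right] at hsum
  have hθ : ∀ {x y : A}, x + θ x = y → θ x = -x + y := fun h => by rw [← h]; abel
  rcases ha with ha | ha <;> rcases hb with hb | hb <;> rw [ha, hb] at hsum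
  · exact Or.inl ⟨by rw [hθ ha, add_zero], by rw [hθ hb, add_zero]⟩
  · rw [Q.polar_zero_left, Q.polar_zero_left, hba, hbb, mul_one, mul_one, one_mul] at hsum
    exact absurd hsum hone
  · rw [Q.polar_zero_left, Q.polar_zero_left, haa, hab, mul_one, mul_one, one_mul] at hsum
    exact absurd hsum hone
  · exact Or.inr ⟨hθ ha, hθ hb⟩

/-- The involutions 2^n a and 2^n b pair to -1 with b and a respectively, so they are independent
and generate the fixed points. Keeping α and γ general treats the hyperbolic and elliptic forms
together. -/
theorem HasGram.isIso (M : IsInvolutiveMetricGroup q θ) (h2 : ∃ k : ℕ, Nat.card A = 2 ^ k)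
    (hiso : ∀ g h, θ g = g → θ h = h → polar q g h = 1)
    {u v : A} (K : IsKlein θ u v) (htor : ∀ y, y + y = 0 → θ y = y) {n : ℕ}
    (hn : ∀ y : A, 2 ^ (n + 1) • y = 0) {a b : A} {α γ : ℤ} (h : HasGram q n a b α 1 γ) :
    (∀ g, θ g = g → q g = 1) ∧
    ∃ θ' : ZMod (2 ^ (n + 1)) × ZMod (2 ^ (n + 1)) → ZMod (2 ^ (n + 1)) × ZMod (2 ^ (n + 1)),
      2 ≤ n + 1 ∧
      ((θ' = fun p => -p) ∨ (3 ≤ n + 1 ∧ θ' = fun p => -p + 2 ^ (n + 1 - 1) • p)) ∧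
      IsIso q θ (fun p => zeta (2 ^ (n + 1)) ^
        (α * (p.1.val : ℤ) ^ 2 + (p.1.val : ℤ) * p.2.val + γ * (p.2.val : ℤ) ^ 2)) θ' := by
  have Q := M.quad
  have hone := circle_neg_one_ne_one
  have hζ : zeta (2 ^ (n + 1)) ^ 2 ^ (n + 1) = 1 := zeta_pow_self _ (by positivity)
  have hval : ∀ {c : A} {δ : ℤ}, q c = zeta (2 ^ (n + 1)) ^ δ → q c ^ 2 ^ (n + 1) = 1 := by
    intro c δ hc
    rw [hc, ← zpow_natCast, ← zpow_mul, mul_comm, zpow_mul, zpow_natCast, hζ, one_zpow]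
  have hself : ∀ {c : A} {δ : ℤ}, q c = zeta (2 ^ (n + 1)) ^ δ → polar q (2 ^ n • c) c = 1 := by
    intro c δ hc
    rw [Q.polar_nsmul_left, Q.polar_self, ← pow_mul, ← pow_succ', hval hc]
  have haa := hself h.left
  have hbb := hself h.right
  have hmid : polar q a b ^ 2 ^ n = -1 := by
    rw [h.mid, zpow_one, pow_succ', zeta_two_mul_pow _ (by positivity)]
  have hab : polar q (2 ^ n • a) b = -1 := by rw [Q.polar_nsmul_left, hmid]
  have hba : polar q (2 ^ n • b) a = -1 := by
    rw [Q.polar_nsmul_left, IsQuadraticForm.polar_comm, hmid]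
  have hfix : ∀ c : A, 2 ^ n • c + 2 ^ n • c = 0 := fun c => by
    rw [← two_nsmul, ← mul_nsmul, ← pow_succ, hn]
  have ha0 : 2 ^ n • a ≠ 0 := fun h0 => by
    rw [h0, Q.polar_zero_left] at hab
    exact hone hab.symm
  have hb0 : 2 ^ n • b ≠ 0 := fun h0 => by
    rw [h0, Q.polar_zero_left] at hba
    exact hone hba.symm
  have hne : 2 ^ n • b ≠ 2 ^ n • a := fun h0 => by
    rw [h0, haa] at hba
    exact hone hba.symm
  -- the fixed points are generated by the involutions of the two summands
  have hK : IsKlein θ (2 ^ n • a) (2 ^ n • b) := by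
    obtain ⟨g, K'⟩ := K.exists_right (htor _ (hfix a)) ha0
    rcases K'.mem _ (htor _ (hfix b)) with h' | h' | h' | h'
    · exact absurd h' hb0
    · exact absurd h' hne
    · rwa [h']
    · rw [h']
      exact K'.add_right
  have hn1 : 1 ≤ n := by
    rw [Nat.one_le_iff_ne_zero]
    rintro rfl
    have h₁ := hK.map_left
    have h₂ := hK.map_right
    have := hiso _ _ h₁ h₂
    rw [pow_zero, one_nsmul] at hab
    rw [pow_zero, one_nsmul, one_nsmul, hab] at this
    exact hone this
  have htop : ∀ {c : A} {δ : ℤ}, q c = zeta (2 ^ (n + 1)) ^ δ → q (2 ^ n • c) = 1 := by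
    intro c δ hc
    obtain ⟨m, rfl⟩ : ∃ m, n = m + 1 := ⟨n - 1, by omega⟩
    rw [Q.map_nsmul, show (2 ^ (m + 1)) ^ 2 = 2 ^ (m + 1 + 1) * 2 ^ m by ring, pow_mul, hval hc,
      one_pow]
  have hq : ∀ g, θ g = g → q g = 1 := by
    intro g hg
    rcases hK.mem g hg with rfl | rfl | rfl | rfl
    · exact Q.map_zero
    · exact htop h.left
    · exact htop h.right
    · rw [IsQuadraticForm.map_add q, htop h.left, htop h.right,
        hiso _ _ hK.map_left hK.map_right, mul_one, mul_one]
  refine ⟨hq, ?_⟩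
  have hθ := map_eq_or_of_even M hK hq haa hab hba hbb
  have hinj : Function.Injective ((cyc (hn a)).coprod (cyc (hn b))) :=
    injective_coprod_of_involutions ⟨_, card_zmod_two_pow _⟩ ⟨_, card_zmod_two_pow _⟩ _ _
      (cyc_involution (hn a)) (cyc_involution (hn b)) hK.left_ne hK.right_ne hK.add_ne_zero
  have hsurj : Function.Surjective ((cyc (hn a)).coprod (cyc (hn b))) := by
    refine M.surjective_of_klein h2 hK _ ⟨(((2 ^ n : ℕ) : ℤ), 0), ?_⟩
      ⟨(0, ((2 ^ n : ℕ) : ℤ)), ?_⟩ fun y hy h => ?_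
    · rw [AddMonoidHom.coprod_apply, map_zero, add_zero, cyc_intCast, natCast_zsmul]
    · rw [AddMonoidHom.coprod_apply, map_zero, zero_add, cyc_intCast, natCast_zsmul]
    · have h₁ := h (1, 0)
      have h₂ := h (0, 1)
      rw [AddMonoidHom.coprod_apply, map_zero, add_zero, cyc_one] at h₁
      rw [AddMonoidHom.coprod_apply, map_zero, zero_add, cyc_one] at h₂
      rcases hK.mem y hy with h' | h' | h' | h' <;> rw [h'] at h₁ h₂
      · exact h'
      · exact absurd (hab.symm.trans h₂) hone
      · exact absurd (hba.symm.trans h₁) hone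
      · rw [Q.polar_add_left, haa, hba, one_mul] at h₁
        exact absurd h₁ hone
  have hform : ∀ p, q ((cyc (hn a)).coprod (cyc (hn b)) p) = zeta (2 ^ (n + 1)) ^
      (α * (p.1.val : ℤ) ^ 2 + (p.1.val : ℤ) * p.2.val + γ * (p.2.val : ℤ) ^ 2) := by
    intro p
    rw [AddMonoidHom.coprod_apply, cyc_apply, cyc_apply, (h.combine Q _ _).right]
    congr 1
    ring
  rcases hθ with ⟨hθa, hθb⟩ | ⟨hθa, hθb⟩
  · refine ⟨fun p => -p, by omega, Or.inl rfl, isIso_of_hom _ hinj hsurj hform fun p => ?_⟩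
    rw [map_neg, AddMonoidHom.coprod_apply, cyc_apply, cyc_apply, map_add, map_zsmul, map_zsmul,
      hθa, hθb]
    module
  -- For n = 1 the twisted formula would read θa = a, although 2a ≠ 0.
  · have hn2 : n ≠ 1 := by
      rintro rfl
      have : θ a = a := by rw [hθa, pow_one, two_nsmul]; abel
      have := hK.add_self this
      rw [← two_nsmul] at this
      exact ha0 (by rwa [pow_one])
    refine ⟨fun p => -p + 2 ^ (n + 1 - 1) • p, by omega, Or.inr ⟨by omega, rfl⟩,
      isIso_of_hom _ hinj hsurj hform fun p => ?_⟩
    rw [map_add, map_neg, map_nsmul, AddMonoidHom.coprod_apply, cyc_apply, cyc_apply, map_add,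
      map_zsmul, map_zsmul, hθa, hθb, Nat.add_sub_cancel]
    module

/-- Take b of maximal order 2^(n+1) and a pairing to -1 with 2^n b. Evenness makes all values of q
powers of ζ of order 2^(n+1), and ⟨a, b⟩ is an odd power, so the binary reduction applies. -/
theorem classify_even (M : IsInvolutiveMetricGroup q θ) (h2 : ∃ k : ℕ, Nat.card A = 2 ^ k)
    (hiso : ∀ g h, θ g = g → θ h = h → polar q g h = 1)
    {u v : A} (K : IsKlein θ u v) (htor : ∀ y, y + y = 0 → θ y = y)
    (heven : ∀ (c : A) (k : ℕ), 2 ^ (k + 1) • c = 0 → polar q c (2 ^ k • c) = 1) :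
    (∀ g, θ g = g → q g = 1) ∧
    ∃ (n : ℕ) (q' : ZMod (2 ^ n) × ZMod (2 ^ n) → Circle)
      (θ' : ZMod (2 ^ n) × ZMod (2 ^ n) → ZMod (2 ^ n) × ZMod (2 ^ n)),
      2 ≤ n ∧ (q' = hyperbolicForm (2 ^ n) ∨ q' = ellipticForm (2 ^ n)) ∧
      ((θ' = fun p => -p) ∨ (3 ≤ n ∧ θ' = fun p => -p + 2 ^ (n - 1) • p)) ∧
      IsIso q θ q' θ' := by
  have Q := M.quad
  -- `2ⁿ⁺¹` is the exponent of the group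
  obtain ⟨n, hn, b, hb⟩ : ∃ n : ℕ, (∀ y : A, 2 ^ (n + 1) • y = 0) ∧ ∃ b : A, 2 ^ n • b ≠ 0 := by
    obtain ⟨k, hk⟩ := h2
    have hex : ∃ n : ℕ, ∀ y : A, 2 ^ n • y = 0 := ⟨k, fun y => by
      rw [← hk]; exact card_nsmul_eq_zero'⟩
    classical
    have h0 : Nat.find hex ≠ 0 := by
      intro h0
      have := Nat.find_spec hex
      rw [h0] at this
      exact K.left_ne (by simpa using this u)
    obtain ⟨n, hn⟩ := Nat.exists_eq_succ_of_ne_zero h0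
    have h₁ := Nat.find_spec hex
    have h₂ := Nat.find_min hex (m := n) (by omega)
    rw [hn] at h₁
    push Not at h₂
    exact ⟨n, h₁, h₂⟩
  obtain ⟨a, ha⟩ := M.exists_polar_eq_neg_one hb (by
    rw [← two_nsmul, ← mul_nsmul, ← pow_succ, hn])
  have hζ : ∀ c : A, ∃ α : ℤ, q c = zeta (2 ^ (n + 1)) ^ α := by
    intro c
    obtain ⟨r, hr⟩ := exists_zeta_zpow (z := q c) (N := 2 ^ (n + 1)) (by positivity) (by
      rw [pow_succ', pow_mul, ← Q.polar_self, ← Q.polar_nsmul_right, heven c n (hn c)])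
    exact ⟨r, by rw [hr, zpow_natCast]⟩
  obtain ⟨α, hα⟩ := hζ a
  obtain ⟨γ, hγ⟩ := hζ b
  obtain ⟨β, hβ, hβ'⟩ := exists_odd_zeta_zpow (z := polar q a b) (N := 2 ^ n) (by positivity) (by
    rw [← Q.polar_nsmul_right, ha])
  rw [← pow_succ'] at hβ'
  have hgram : HasGram q n a b α β γ := ⟨hα, hβ', hγ⟩
  obtain ⟨a', b', h | h⟩ := hgram.exists_normal_form Q hβ
  · obtain ⟨hq, θ', hn2, hθ', hI⟩ := h.isIso M h2 hiso K htor hn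
    refine ⟨hq, n + 1, _, θ', hn2, Or.inl rfl, hθ', ?_⟩
    convert hI using 2 with p
    rw [hyperbolicForm, ← zpow_natCast]
    congr 1
    push_cast
    ring
  · obtain ⟨hq, θ', hn2, hθ', hI⟩ := h.isIso M h2 hiso K htor hn
    refine ⟨hq, n + 1, _, θ', hn2, Or.inr rfl, hθ', ?_⟩
    convert hI using 2 with p
    rw [ellipticForm, ← zpow_natCast]
    congr 1
    push_cast
    ring

end


section

variable {A : Type*} [AddCommGroup A] {q : A → Circle} {θ : A ≃+ A}

/-! ### Isotropic fixed subgroups -/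

theorem classify_fixed_two_torsion (M : IsInvolutiveMetricGroup q θ)
    (h2 : ∃ k : ℕ, Nat.card A = 2 ^ k) (hiso : ∀ g h, θ g = g → θ h = h → polar q g h = 1)
    {u v : A} (K : IsKlein θ u v) (htor : ∀ y, y + y = 0 → θ y = y) :
    ((∃ g, θ g = g ∧ q g = -1) ∧
      ∃ (n : ℕ) (r₁ r₂ : ℤ) (θ' : ZMod 4 × ZMod (2 ^ n) → ZMod 4 × ZMod (2 ^ n)),
        2 ≤ n ∧ Odd r₁ ∧ Odd r₂ ∧ ((θ' = fun p => -p) ∨ (3 ≤ n ∧ θ' = twistFour n)) ∧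
        IsIso q θ (prodForm (cyclicForm 4 r₁) (cyclicForm (2 ^ n) r₂)) θ') ∨
    ((∀ g, θ g = g → q g = 1) ∧
      ((∃ (n : ℕ) (q' : ZMod (2 ^ n) × ZMod (2 ^ n) → Circle)
          (θ' : ZMod (2 ^ n) × ZMod (2 ^ n) → ZMod (2 ^ n) × ZMod (2 ^ n)),
          2 ≤ n ∧ (q' = hyperbolicForm (2 ^ n) ∨ q' = ellipticForm (2 ^ n)) ∧
          ((θ' = fun p => -p) ∨ (3 ≤ n ∧ θ' = fun p => -p + 2 ^ (n - 1) • p)) ∧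
          IsIso q θ q' θ') ∨
        (∃ (m n : ℕ) (r₁ r₂ : ℤ)
          (θ' : ZMod (2 ^ m) × ZMod (2 ^ n) → ZMod (2 ^ m) × ZMod (2 ^ n)),
          3 ≤ m ∧ m ≤ n ∧ Odd r₁ ∧ Odd r₂ ∧ ((θ' = fun p => -p) ∨ θ' = twistDiag m n) ∧
          IsIso q θ (prodForm (cyclicForm (2 ^ m) r₁) (cyclicForm (2 ^ n) r₂)) θ'))) := by
  by_cases hodd : ∃ (c : A) (k : ℕ), 2 ^ (k + 1) • c = 0 ∧ polar q c (2 ^ k • c) ≠ 1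
  · obtain ⟨c, k, hck, hc⟩ := hodd
    have hfix : 2 ^ k • c + 2 ^ k • c = 0 := by rw [← two_nsmul, ← mul_nsmul, ← pow_succ, hck]
    obtain ⟨d, l, D⟩ := exists_isDiagonalBasis M h2 K htor hck
      ((M.polar_eq_or hfix c).resolve_left hc)
    rcases le_total k l with hkl | hkl
    · exact (D.classify M h2 hiso hkl).imp_right fun h => ⟨h.1, Or.inr h.2⟩
    · exact (D.symm.classify M h2 hiso hkl).imp_right fun h => ⟨h.1, Or.inr h.2⟩
  · push Not at hodd
    obtain ⟨hq, h⟩ := classify_even M h2 hiso K htor hodd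
    exact Or.inr ⟨hq, Or.inl h⟩

/-- If no involution has a trace with q = -1, the only possible nonzero trace is a, and a unique
nonzero trace is impossible. So all involutions are fixed. -/
theorem classify_of_isotropic_nontrivial (M : IsInvolutiveMetricGroup q θ)
    (h2 : ∃ k : ℕ, Nat.card A = 2 ^ k) {a b : A} (K : IsKlein θ a b) (ha : q a = 1)
    (hb : q b = -1) (hab : q (a + b) = -1) :
    (∃ (n : ℕ) (r₁ r₂ : ℤ) (θ' : ZMod 4 × ZMod (2 ^ n) → ZMod 4 × ZMod (2 ^ n)),
      2 ≤ n ∧ Odd r₁ ∧ Odd r₂ ∧ ((θ' = fun p => -p) ∨ (3 ≤ n ∧ θ' = twistFour n)) ∧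
      IsIso q θ (prodForm (cyclicForm 4 r₁) (cyclicForm (2 ^ n) r₂)) θ') ∨
    (∃ (n : ℕ) (r : ℤ) (q' : ZMod 2 × ZMod 2 → Circle), 2 ≤ n ∧ Odd r ∧ IsFlipForm q' ∧
      IsIso q θ
        (fun p : ZMod 2 × ZMod 2 × ZMod (2 ^ n) =>
          q' (p.1, p.2.1) * cyclicForm (2 ^ n) r p.2.2)
        (fun p => (p.2.1, p.1, -p.2.2))) ∨
    (∃ q' q'' : ZMod 2 × ZMod 2 → Circle, IsFlipForm q' ∧ IsFlipForm q'' ∧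
      IsIso q θ
        (fun p : ZMod 2 × ZMod 2 × ZMod 2 × ZMod 2 =>
          q' (p.1, p.2.2.1) * q'' (p.2.1, p.2.2.2))
        swapFour) := by
  have Q := M.quad
  have haa : polar q a a = 1 := by rw [Q.polar_self, ha, one_pow]
  have hbb : polar q b b = 1 := by rw [Q.polar_self, hb, neg_one_sq]
  have hpab : polar q a b = 1 := by
    rw [IsQuadraticForm.map_add q, ha, hb, one_mul, neg_one_mul, neg_inj] at hab
    exact hab
  have hiso : ∀ g h, θ g = g → θ h = h → polar q g h = 1 := fun g h hg hh =>
    polar_fixed_fixed M K haa hbb hpab hg hh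
  by_cases hx : ∃ x, x + x = 0 ∧ q (x + θ x) = -1
  · obtain ⟨x, hxx, hqx⟩ := hx
    have hx0 : x + θ x ≠ 0 := fun h => by
      rw [h, Q.map_zero] at hqx
      exact circle_neg_one_ne_one hqx.symm
    have hfix := M.map_add_map x
    obtain ⟨g, K'⟩ := K.exists_right hfix hx0
    refine Or.inr (classify_of_flip M h2 K'.symm (hiso _ _ K'.map_right K'.map_right)
      (hiso _ _ hfix hfix) (hiso _ _ K'.map_right hfix) hxx rfl ?_)
    rw [IsQuadraticForm.polar_comm, ← M.form_add_map, hqx]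
  · push Not at hx
    have htr : ∀ y, y + y = 0 → θ y = y ∨ y + θ y = a := by
      intro y hy
      rcases K.mem _ (M.map_add_map y) with h | h | h | h
      · left
        rw [eq_neg_of_add_eq_zero_right h, neg_eq_self hy]
      · exact Or.inr h
      · exact absurd (by rw [h, hb]) (hx y hy)
      · exact absurd (by rw [h, hab]) (hx y hy)
    have htor : ∀ y, y + y = 0 → θ y = y := by
      intro y hy
      refine (htr y hy).resolve_right fun h => ?_
      exact false_of_unique_trace M K.symm haa hpab ha hy h htr
    rcases classify_fixed_two_torsion M h2 hiso K htor with ⟨-, h⟩ | ⟨h, -⟩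
    · exact Or.inl h
    · rw [h b K.map_right] at hb
      exact absurd hb.symm circle_neg_one_ne_one

theorem classify_of_form_eq_one (M : IsInvolutiveMetricGroup q θ)
    (h2 : ∃ k : ℕ, Nat.card A = 2 ^ k) {a b : A} (K : IsKlein θ a b) (ha : q a = 1)
    (hb : q b = 1) (hab : q (a + b) = 1) :
    (∃ (n : ℕ) (q' : ZMod (2 ^ n) × ZMod (2 ^ n) → Circle)
      (θ' : ZMod (2 ^ n) × ZMod (2 ^ n) → ZMod (2 ^ n) × ZMod (2 ^ n)),
      2 ≤ n ∧ (q' = hyperbolicForm (2 ^ n) ∨ q' = ellipticForm (2 ^ n)) ∧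
      ((θ' = fun p => -p) ∨ (3 ≤ n ∧ θ' = fun p => -p + 2 ^ (n - 1) • p)) ∧
      IsIso q θ q' θ') ∨
    (∃ (m n : ℕ) (r₁ r₂ : ℤ)
      (θ' : ZMod (2 ^ m) × ZMod (2 ^ n) → ZMod (2 ^ m) × ZMod (2 ^ n)),
      3 ≤ m ∧ m ≤ n ∧ Odd r₁ ∧ Odd r₂ ∧ ((θ' = fun p => -p) ∨ θ' = twistDiag m n) ∧
      IsIso q θ (prodForm (cyclicForm (2 ^ m) r₁) (cyclicForm (2 ^ n) r₂)) θ') ∨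
    IsIso q θ crossForm swapFour ∨ IsIso q θ crossForm' swapFour := by
  have Q := M.quad
  have haa : polar q a a = 1 := by rw [Q.polar_self, ha, one_pow]
  have hbb : polar q b b = 1 := by rw [Q.polar_self, hb, one_pow]
  have hpab : polar q a b = 1 := by
    rw [IsQuadraticForm.map_add q, ha, hb, one_mul, one_mul] at hab
    exact hab
  have hiso : ∀ g h, θ g = g → θ h = h → polar q g h = 1 := fun g h hg hh =>
    polar_fixed_fixed M K haa hbb hpab hg hh
  have hq : ∀ g, θ g = g → q g = 1 := by
    intro g hg
    rcases K.mem g hg with rfl | rfl | rfl | rfl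
    exacts [Q.map_zero, ha, hb, hab]
  by_cases hx : ∃ x, x + x = 0 ∧ θ x ≠ x
  · obtain ⟨x, hxx, hθx⟩ := hx
    have hfix := M.map_add_map x
    have hx0 : x + θ x ≠ 0 := fun h =>
      hθx (by rw [eq_neg_of_add_eq_zero_right h, neg_eq_self hxx])
    obtain ⟨g, K'⟩ := K.exists_right hfix hx0
    by_cases hall : ∀ y, y + y = 0 → θ y = y ∨ y + θ y = x + θ x
    · exact (false_of_unique_trace M K'.symm (hiso _ _ hfix hfix)
        (hiso _ _ hfix K'.map_right) (hq _ hfix) hxx rfl hall).elim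
    · push Not at hall
      obtain ⟨y, hyy, hθy, hyx⟩ := hall
      have hK : IsKlein θ (x + θ x) (y + θ y) := by
        rcases K'.mem _ (M.map_add_map y) with h | h | h | h
        · exact absurd (by rw [eq_neg_of_add_eq_zero_right h, neg_eq_self hyy]) hθy
        · exact absurd h hyx
        · rwa [h]
        · rw [h]
          exact K'.add_right
      exact Or.inr (Or.inr (isIso_cross_or M h2 hq hxx hyy hK))
  · push Not at hx
    rcases classify_fixed_two_torsion M h2 hiso K hx with ⟨⟨g, hg, hqg⟩, -⟩ | ⟨-, h | h⟩
    · rw [hq g hg] at hqg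
      exact absurd hqg.symm circle_neg_one_ne_one
    · exact Or.inl h
    · exact Or.inr (Or.inl h)

/-! ### Labellings of the fixed subgroup -/

theorem isKlein_of_eq (hfix : Nonempty (fixedSubgroup θ ≃+ ZMod 2 × ZMod 2)) {a₀ a₁ a₂ : A}
    (h : (fixedSubgroup θ : Set A) = {0, a₀, a₁, a₂}) : IsKlein θ a₀ a₁ ∧ a₂ = a₀ + a₁ := by
  obtain ⟨e⟩ := hfix
  have hmem : ∀ g, θ g = g ↔ g = 0 ∨ g = a₀ ∨ g = a₁ ∨ g = a₂ := fun g => by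
    have : θ g = g ↔ g ∈ (fixedSubgroup θ : Set A) := Iff.rfl
    rw [this, h]
    simp
  have hcard : (fixedSubgroup θ : Set A).ncard = 4 := by
    rw [← Nat.card_coe_set_eq]
    exact (Nat.card_congr e.toEquiv).trans (by simp)
  -- Any coincidence among 0, a₀, a₁, a₂ would leave at most three fixed points.
  have h3 : ∀ x y z : A, (fixedSubgroup θ : Set A) ≠ {x, y, z} := by
    intro x y z hxyz
    have h₁ := Set.ncard_insert_le x {y, z}
    have h₂ := Set.ncard_insert_le y {z}
    rw [Set.ncard_singleton] at h₂
    rw [hxyz] at hcard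
    omega
  have hadd : ∀ g, θ g = g → g + g = 0 := by
    intro g hg
    have h0 : ∀ p : ZMod 2 × ZMod 2, p + p = 0 := by decide
    have : (⟨g, hg⟩ : fixedSubgroup θ) + ⟨g, hg⟩ = 0 := e.injective (by rw [map_add, h0, map_zero])
    exact congrArg Subtype.val this
  have h₀ := (hmem a₀).2 (by simp)
  have h₁ := (hmem a₁).2 (by simp)
  have hne₀ : a₀ ≠ 0 := by
    rintro rfl
    exact h3 0 a₁ a₂ (by rw [h]; simp)
  have hne₁ : a₁ ≠ 0 := by
    rintro rfl
    exact h3 0 a₀ a₂ (by rw [h]; ext; simp; tauto)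
  have hne : a₀ ≠ a₁ := by
    rintro rfl
    exact h3 0 a₀ a₂ (by rw [h]; simp)
  have hsum : a₀ + a₁ = a₂ := by
    rcases (hmem (a₀ + a₁)).1 (by rw [map_add, h₀, h₁]) with h' | h' | h' | h'
    · exact absurd (by rw [← neg_eq_self (hadd a₁ h₁), ← eq_neg_of_add_eq_zero_left h']) hne
    · exact absurd (by simpa using h') hne₁
    · exact absurd (by simpa using h') hne₀
    · exact h'
  exact ⟨⟨hadd _ h₀, hadd _ h₁, h₀, h₁, hne₀, hne₁, hne, fun g hg => hsum ▸ (hmem g).1 hg⟩,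
    hsum.symm⟩

theorem exists_fixedSubgroup_eq (hfix : Nonempty (fixedSubgroup θ ≃+ ZMod 2 × ZMod 2)) :
    ∃ a₀ a₁ a₂ : A, (fixedSubgroup θ : Set A) = {0, a₀, a₁, a₂} := by
  obtain ⟨e⟩ := hfix
  refine ⟨e.symm (1, 0), e.symm (0, 1), e.symm (1, 1), ?_⟩
  ext g
  constructor
  · intro hg
    have hp : ∀ p : ZMod 2 × ZMod 2, p = 0 ∨ p = (1, 0) ∨ p = (0, 1) ∨ p = (1, 1) := by decide
    have hg' : (e.symm (e ⟨g, hg⟩) : A) = g := by rw [e.symm_apply_apply]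
    rcases hp (e ⟨g, hg⟩) with h | h | h | h <;> rw [h] at hg' <;> simp [← hg']
  · rintro (rfl | rfl | rfl | rfl)
    · exact zero_mem _
    all_goals exact Subtype.property _

theorem coe_form_of_involution (Q : IsQuadraticForm q) {x : A} (hx : x + x = 0) :
    (q x : ℂ) = 1 ∨ (q x : ℂ) = -1 ∨ (q x : ℂ) = Complex.I ∨ (q x : ℂ) = -Complex.I := by
  have h4 : (q x ^ 2) ^ 2 = 1 := by
    rw [sq (q x ^ 2), ← Q.polar_self, ← Q.polar_add_right, hx, Q.polar_zero_right]
  rcases circle_sq_eq_one.1 h4 with h | h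
  · rcases circle_sq_eq_one.1 h with h | h <;> simp [h]
  · rcases circle_sq_eq_neg_one h with h | h <;> simp [h, coe_zeta_four]

end

end InvMetric

/-! ### Labellings and the final classification -/

open InvMetric Complex in
theorem exists_labelling {A : Type*} [AddCommGroup A] {q : A → Circle} {θ : A ≃+ A}
    (M : IsInvolutiveMetricGroup q θ) (hfix : Nonempty (fixedSubgroup θ ≃+ ZMod 2 × ZMod 2)) :
    ∃ a₀ a₁ a₂ : A, (fixedSubgroup θ : Set A) = {0, a₀, a₁, a₂} ∧
      (TakesValues q a₀ a₁ a₂ (-1) 1 1 ∨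
       TakesValues q a₀ a₁ a₂ (-1) (-1) (-1) ∨
       (TakesValues q a₀ a₁ a₂ (-1) I I ∨ TakesValues q a₀ a₁ a₂ (-1) (-I) (-I)) ∨
       TakesValues q a₀ a₁ a₂ 1 I (-I) ∨
       TakesValues q a₀ a₁ a₂ (-1) I (-I) ∨
       TakesValues q a₀ a₁ a₂ 1 (-1) (-1) ∨
       (TakesValues q a₀ a₁ a₂ 1 I I ∨ TakesValues q a₀ a₁ a₂ 1 (-I) (-I)) ∨
       TakesValues q a₀ a₁ a₂ 1 1 1) := by
  obtain ⟨a₀, a₁, a₂, h⟩ := exists_fixedSubgroup_eq hfix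
  obtain ⟨K, h'⟩ := isKlein_of_eq hfix h
  have s₁ : (fixedSubgroup θ : Set A) = {0, a₀, a₂, a₁} := by rw [h, Set.pair_comm a₁ a₂]
  have s₂ : (fixedSubgroup θ : Set A) = {0, a₁, a₀, a₂} := by rw [h, Set.insert_comm a₀ a₁]
  have s₃ : (fixedSubgroup θ : Set A) = {0, a₂, a₀, a₁} := by rw [s₁, Set.insert_comm a₀ a₂]
  have s₄ : (fixedSubgroup θ : Set A) = {0, a₁, a₂, a₀} := by rw [s₂, Set.pair_comm a₀ a₂]
  have s₅ : (fixedSubgroup θ : Set A) = {0, a₂, a₁, a₀} := by rw [s₃, Set.pair_comm a₀ a₁]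
  have hq : (q a₂ : ℂ) = q a₀ * q a₁ * polar q a₀ a₁ := by
    rw [h', IsQuadraticForm.map_add q]; simp
  clear h'
  -- Four values each for q(a₀) and q(a₁) and two for their pairing determine q(a₂). In each of the
  -- 32 combinations one of the six orderings fits the list.
  rcases coe_form_of_involution M.quad K.add_self_left with h₀ | h₀ | h₀ | h₀ <;>
    rcases coe_form_of_involution M.quad K.add_self_right with h₁ | h₁ | h₁ | h₁ <;>
    rcases M.polar_eq_or K.add_self_right a₀ with hB | hB <;>
    rw [h₀, h₁, hB] at hq <;>
    simp only [Circle.coe_one, Circle.coe_neg, mul_one, one_mul, mul_neg, neg_mul, neg_neg,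
      I_mul_I] at hq <;>
    first
    | refine ⟨_, _, _, h, ?_⟩
      simp [TakesValues, h₀, h₁, hq]
      done
    | refine ⟨_, _, _, s₁, ?_⟩
      simp [TakesValues, h₀, h₁, hq]
      done
    | refine ⟨_, _, _, s₂, ?_⟩
      simp [TakesValues, h₀, h₁, hq]
      done
    | refine ⟨_, _, _, s₃, ?_⟩
      simp [TakesValues, h₀, h₁, hq]
      done
    | refine ⟨_, _, _, s₄, ?_⟩
      simp [TakesValues, h₀, h₁, hq]
      done
    | refine ⟨_, _, _, s₅, ?_⟩
      simp [TakesValues, h₀, h₁, hq]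

open InvMetric Complex in
theorem theorem2p4 {A : Type*} [AddCommGroup A] (q : A → Circle) (θ : A ≃+ A)
    (hA : IsInvolutiveMetricGroup q θ) (h2 : ∃ k : ℕ, Nat.card A = 2 ^ k)
    (hfix : Nonempty (fixedSubgroup θ ≃+ ZMod 2 × ZMod 2)) :
    -- the eight cases are exhaustive, up to the labelling of the nonzero fixed points
    (∃ a₀ a₁ a₂ : A, (fixedSubgroup θ : Set A) = {0, a₀, a₁, a₂} ∧
      (TakesValues q a₀ a₁ a₂ (-1) 1 1 ∨
       TakesValues q a₀ a₁ a₂ (-1) (-1) (-1) ∨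
       (TakesValues q a₀ a₁ a₂ (-1) I I ∨ TakesValues q a₀ a₁ a₂ (-1) (-I) (-I)) ∨
       TakesValues q a₀ a₁ a₂ 1 I (-I) ∨
       TakesValues q a₀ a₁ a₂ (-1) I (-I) ∨
       TakesValues q a₀ a₁ a₂ 1 (-1) (-1) ∨
       (TakesValues q a₀ a₁ a₂ 1 I I ∨ TakesValues q a₀ a₁ a₂ 1 (-I) (-I)) ∨
       TakesValues q a₀ a₁ a₂ 1 1 1)) ∧
    ∀ a₀ a₁ a₂ : A, (fixedSubgroup θ : Set A) = {0, a₀, a₁, a₂} →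
      -- (1)
      (TakesValues q a₀ a₁ a₂ (-1) 1 1 →
        IsIso q θ (hyperbolicForm 2) (fun p => -p)) ∧
      -- (2)
      (TakesValues q a₀ a₁ a₂ (-1) (-1) (-1) →
        IsIso q θ (ellipticForm 2) (fun p => -p)) ∧
      -- (3)
      (∀ ε : ℤ, ε = 1 ∨ ε = -1 → TakesValues q a₀ a₁ a₂ (-1) (ε * I) (ε * I) →
        IsIso q θ (prodForm (cyclicForm 2 ε) (cyclicForm 2 ε)) (fun p => -p)) ∧
      -- (4)
      (TakesValues q a₀ a₁ a₂ 1 I (-I) →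
        IsIso q θ (prodForm (cyclicForm 2 1) (cyclicForm 2 (-1))) (fun p => -p)) ∧
      -- (5)
      (TakesValues q a₀ a₁ a₂ (-1) I (-I) →
        (∃ r₁ r₂ : ℤ, Odd r₁ ∧ Odd r₂ ∧
          IsIso q θ (prodForm (cyclicForm 2 r₁) (cyclicForm 4 r₂)) (fun p => -p)) ∨
        (∃ (r : ℤ) (q' : ZMod 2 × ZMod 2 → Circle), Odd r ∧ IsFlipForm q' ∧
          IsIso q θ (prodForm (cyclicForm 2 r) q') (fun p => (p.1, p.2.2, p.2.1)))) ∧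
      -- (6)
      (TakesValues q a₀ a₁ a₂ 1 (-1) (-1) →
        (∃ (n : ℕ) (r₁ r₂ : ℤ) (θ' : ZMod 4 × ZMod (2 ^ n) → ZMod 4 × ZMod (2 ^ n)),
          2 ≤ n ∧ Odd r₁ ∧ Odd r₂ ∧ ((θ' = fun p => -p) ∨ (3 ≤ n ∧ θ' = twistFour n)) ∧
          IsIso q θ (prodForm (cyclicForm 4 r₁) (cyclicForm (2 ^ n) r₂)) θ') ∨
        (∃ (n : ℕ) (r : ℤ) (q' : ZMod 2 × ZMod 2 → Circle), 2 ≤ n ∧ Odd r ∧ IsFlipForm q' ∧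
          IsIso q θ
            (fun p : ZMod 2 × ZMod 2 × ZMod (2 ^ n) =>
              q' (p.1, p.2.1) * cyclicForm (2 ^ n) r p.2.2)
            (fun p => (p.2.1, p.1, -p.2.2))) ∨
        (∃ q' q'' : ZMod 2 × ZMod 2 → Circle, IsFlipForm q' ∧ IsFlipForm q'' ∧
          IsIso q θ
            (fun p : ZMod 2 × ZMod 2 × ZMod 2 × ZMod 2 =>
              q' (p.1, p.2.2.1) * q'' (p.2.1, p.2.2.2))
            swapFour)) ∧
      -- (7)
      (∀ ε : ℤ, ε = 1 ∨ ε = -1 → TakesValues q a₀ a₁ a₂ 1 (ε * I) (ε * I) →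
        ∃ (n : ℕ) (r : ℤ), 3 ≤ n ∧ Odd r ∧
          IsIso q θ (prodForm (cyclicForm 2 ε) (cyclicForm (2 ^ n) r)) (fun p => -p)) ∧
      -- (8)
      (TakesValues q a₀ a₁ a₂ 1 1 1 →
        (∃ (n : ℕ) (q' : ZMod (2 ^ n) × ZMod (2 ^ n) → Circle)
          (θ' : ZMod (2 ^ n) × ZMod (2 ^ n) → ZMod (2 ^ n) × ZMod (2 ^ n)),
          2 ≤ n ∧ (q' = hyperbolicForm (2 ^ n) ∨ q' = ellipticForm (2 ^ n)) ∧
          ((θ' = fun p => -p) ∨ (3 ≤ n ∧ θ' = fun p => -p + 2 ^ (n - 1) • p)) ∧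
          IsIso q θ q' θ') ∨
        (∃ (m n : ℕ) (r₁ r₂ : ℤ)
          (θ' : ZMod (2 ^ m) × ZMod (2 ^ n) → ZMod (2 ^ m) × ZMod (2 ^ n)),
          3 ≤ m ∧ m ≤ n ∧ Odd r₁ ∧ Odd r₂ ∧ ((θ' = fun p => -p) ∨ θ' = twistDiag m n) ∧
          IsIso q θ (prodForm (cyclicForm (2 ^ m) r₁) (cyclicForm (2 ^ n) r₂)) θ') ∨
        IsIso q θ crossForm swapFour ∨ IsIso q θ crossForm' swapFour) := by
  refine ⟨exists_labelling hA hfix, fun a₀ a₁ a₂ hset => ?_⟩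
  obtain ⟨K, rfl⟩ := isKlein_of_eq hfix hset
  have Q := hA.quad
  -- The nondegenerate models use the basis a₁, a₂, with a₀ as the sum; hence this change of basis.
  have K' := K.symm.add_right
  rw [add_comm a₁ a₀] at K'
  have hone := circle_neg_one_ne_one
  -- the four nondegenerate cases
  have nondeg : ∀ {q' : ZMod 2 × ZMod 2 → Circle},
      (∀ y, θ y = y → polar q y a₁ = 1 → polar q y (a₀ + a₁) = 1 → y = 0) →
      (∀ x y : ZMod 2, q a₁ ^ ((x.val : ℤ) ^ 2) * q (a₀ + a₁) ^ ((y.val : ℤ) ^ 2) *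
        polar q a₁ (a₀ + a₁) ^ ((x.val : ℤ) * y.val) = q' (x, y)) →
      IsIso q θ q' (fun p => -p) := fun h h' => isIso_of_klein_nondegenerate hA h2 K' h h'
  have hpolar : q a₀ = q a₁ * q (a₀ + a₁) * polar q a₁ (a₀ + a₁) := by
    have h := IsQuadraticForm.map_add q a₁ (a₀ + a₁)
    rwa [add_comm a₀ a₁, K.symm.add_add_self, add_comm a₁ a₀] at h
  -- One hypothesis for each nonzero fixed point, saying that it is outside the radical.
  have hker : (polar q a₁ a₁ ≠ 1 ∨ polar q a₁ (a₀ + a₁) ≠ 1) →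
      (polar q (a₀ + a₁) a₁ ≠ 1 ∨ polar q (a₀ + a₁) (a₀ + a₁) ≠ 1) →
      (polar q a₁ a₁ * polar q (a₀ + a₁) a₁ ≠ 1 ∨
        polar q a₁ (a₀ + a₁) * polar q (a₀ + a₁) (a₀ + a₁) ≠ 1) →
      ∀ y, θ y = y → polar q y a₁ = 1 → polar q y (a₀ + a₁) = 1 → y = 0 := by
    intro h₁ h₂ h₃ y hy hy₁ hy₂
    rcases K'.mem y hy with h | h | h | h
    · exact h
    · rw [h] at hy₁ hy₂
      exact absurd hy₂ (h₁.resolve_left (not_not.2 hy₁))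
    · rw [h] at hy₁ hy₂
      exact absurd hy₂ (h₂.resolve_left (not_not.2 hy₁))
    · rw [h, Q.polar_add_left] at hy₁ hy₂
      exact absurd hy₂ (h₃.resolve_left (not_not.2 hy₁))
  have coe_one : ∀ {z : Circle}, (z : ℂ) = 1 → z = 1 := fun h => Circle.ext h
  have coe_neg_one : ∀ {z : Circle}, (z : ℂ) = -1 → z = -1 := fun h => Circle.ext (by simpa using h)
  have coe_I : ∀ {z : Circle}, (z : ℂ) = I → z = zeta 4 := fun h =>
    Circle.ext (by rw [h, coe_zeta_four])
  have coe_zpow : ∀ {z : Circle} {ε : ℤ}, ε = 1 ∨ ε = -1 → (z : ℂ) = ε * I → z = zeta 4 ^ ε := by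
    rintro z ε (rfl | rfl) h <;> refine Circle.ext ?_ <;> rw [h, Circle.coe_zpow, coe_zeta_four] <;>
      simp
  have coe_neg_I : ∀ {z : Circle}, (z : ℂ) = -I → z = zeta 4 ^ (-1 : ℤ) := fun h =>
    coe_zpow (Or.inr rfl) (by rw [h]; simp)
  have zeta_sq : zeta 4 ^ 2 = -1 := zeta_two_mul_pow 2 two_ne_zero
  have zeta_zpow_sq : ∀ {ε : ℤ}, ε = 1 ∨ ε = -1 → (zeta 4 ^ ε) ^ 2 = -1 := by
    rintro ε (rfl | rfl)
    · rw [zpow_one, zeta_sq]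
    · rw [zpow_neg_one, inv_pow, zeta_sq, inv_neg, inv_one]
  refine ⟨?_, ?_, ?_, ?_, ?_, ?_, ?_, ?_⟩
  · rintro ⟨h₀, h₁, h₂⟩
    replace h₀ := coe_neg_one h₀; replace h₁ := coe_one h₁; replace h₂ := coe_one h₂
    rw [h₀, h₁, h₂, one_mul, one_mul] at hpolar
    have hs : polar q (a₀ + a₁) a₁ = -1 := by rw [IsQuadraticForm.polar_comm, ← hpolar]
    refine nondeg (hker ?_ ?_ ?_) fun x y => ?_
    · exact Or.inr (by rw [← hpolar]; exact hone)
    · exact Or.inl (by rw [hs]; exact hone)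
    · exact Or.inl (by rw [hs, Q.polar_self, h₁]; simpa using hone)
    · rw [h₁, h₂, ← hpolar, one_zpow, one_zpow, one_mul, one_mul, hyperbolicForm, zeta_two]
      exact_mod_cast rfl
  · rintro ⟨h₀, h₁, h₂⟩
    replace h₀ := coe_neg_one h₀; replace h₁ := coe_neg_one h₁; replace h₂ := coe_neg_one h₂
    rw [h₀, h₁, h₂, neg_mul_neg, one_mul, one_mul] at hpolar
    have hs : polar q (a₀ + a₁) a₁ = -1 := by rw [IsQuadraticForm.polar_comm, ← hpolar]
    refine nondeg (hker ?_ ?_ ?_) fun x y => ?_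
    · exact Or.inr (by rw [← hpolar]; exact hone)
    · exact Or.inl (by rw [hs]; exact hone)
    · exact Or.inl (by rw [hs, Q.polar_self, h₁]; simpa using hone)
    · rw [h₁, h₂, ← hpolar, ← zpow_add, ← zpow_add, ellipticForm, zeta_two, ← zpow_natCast]
      congr 1
      push_cast
      ring
  · rintro ε hε ⟨h₀, h₁, h₂⟩
    replace h₀ := coe_neg_one h₀
    replace h₁ := coe_zpow hε h₁; replace h₂ := coe_zpow hε h₂
    rw [h₀, h₁, h₂, ← sq, zeta_zpow_sq hε, neg_one_mul, neg_inj] at hpolar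
    have hs : polar q (a₀ + a₁) a₁ = 1 := by rw [IsQuadraticForm.polar_comm, ← hpolar]
    have hs₁ : polar q a₁ a₁ = -1 := by rw [Q.polar_self, h₁, zeta_zpow_sq hε]
    have hs₂ : polar q (a₀ + a₁) (a₀ + a₁) = -1 := by rw [Q.polar_self, h₂, zeta_zpow_sq hε]
    refine nondeg (hker ?_ ?_ ?_) fun x y => ?_
    · exact Or.inl (by rw [hs₁]; exact hone)
    · exact Or.inr (by rw [hs₂]; exact hone)
    · exact Or.inl (by rw [hs, hs₁, mul_one]; exact hone)
    · rw [h₁, h₂, ← hpolar, one_zpow, mul_one, ← zpow_mul, ← zpow_mul]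
      rfl
  · rintro ⟨h₀, h₁, h₂⟩
    replace h₀ := coe_one h₀; replace h₁ := coe_I h₁; replace h₂ := coe_neg_I h₂
    rw [h₀, h₁, h₂, zpow_neg_one, mul_inv_cancel, one_mul] at hpolar
    have hs : polar q (a₀ + a₁) a₁ = 1 := by rw [IsQuadraticForm.polar_comm, ← hpolar]
    have hs₁ : polar q a₁ a₁ = -1 := by rw [Q.polar_self, h₁, zeta_sq]
    have hs₂ : polar q (a₀ + a₁) (a₀ + a₁) = -1 := by
      rw [Q.polar_self, h₂, zeta_zpow_sq (Or.inr rfl)]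
    refine nondeg (hker ?_ ?_ ?_) fun x y => ?_
    · exact Or.inl (by rw [hs₁]; exact hone)
    · exact Or.inr (by rw [hs₂]; exact hone)
    · exact Or.inl (by rw [hs, hs₁, mul_one]; exact hone)
    · rw [h₁, h₂, ← hpolar, one_zpow, mul_one, ← zpow_mul, prodForm, cyclicForm, cyclicForm,
        one_mul]
  · rintro ⟨h₀, h₁, h₂⟩
    replace h₀ := coe_neg_one h₀; replace h₁ := coe_I h₁; replace h₂ := coe_neg_I h₂
    have hp : polar q a₀ a₁ = 1 := by
      rw [polar, h₀, h₁, h₂, zpow_neg_one, mul_right_comm, ← mul_inv, ← sq, zeta_sq]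
      simp
    rcases classify_of_line hA h2 K (by rw [h₀, neg_one_sq]) (by rw [h₁, zeta_sq]) hp
      (r := 1) (by rw [h₁, zpow_one]) with ⟨-, q', hq', h⟩ | ⟨k, s, hs, -, hk, h⟩
    · exact Or.inr ⟨1, q', odd_one, hq', h⟩
    -- Here q(a₀) = -1 forces k = 1, so the cyclic summand has order 4.
    · obtain rfl := hk h₀
      exact Or.inl ⟨1, s, odd_one, hs, h⟩
  · rintro ⟨h₀, h₁, h₂⟩
    exact classify_of_isotropic_nontrivial hA h2 K (coe_one h₀) (coe_neg_one h₁) (coe_neg_one h₂)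
  · rintro ε hε ⟨h₀, h₁, h₂⟩
    replace h₀ := coe_one h₀
    replace h₁ := coe_zpow hε h₁; replace h₂ := coe_zpow hε h₂
    have hp : polar q a₀ a₁ = 1 := by
      rw [polar, h₀, h₁, h₂]
      simp
    rcases classify_of_line hA h2 K (by rw [h₀, one_pow]) (by rw [h₁, zeta_zpow_sq hε]) hp
      (r := ε) h₁ with ⟨h, -⟩ | ⟨k, s, hs, hk, -, h⟩
    · exact absurd (h.symm.trans h₀) hone
    · have := hk h₀
      exact ⟨k + 1, s, by omega, hs, h⟩
  · rintro ⟨h₀, h₁, h₂⟩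
    exact classify_of_form_eq_one hA h2 K (coe_one h₀) (coe_one h₁) (coe_one h₂)
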